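/- Let $p,q\ge 0$ be integers, $M>0$, $\Theta_1=[-M,M]\times[-M,M]\times[0,\pi]$ and $\mathcal V=\Theta_1^{p+q}$. For $\vartheta=(A_1,B_1,\alpha_1,\dots,A_p,B_p,\alpha_p,C_1,D_1,\beta_1,\dots,C_q,D_q,\beta_q)$ put $$\mu_\vartheta(t)=\sum_{j=1}^p\{A_j\cos(\alpha_jt)+B_j\sin(\alpha_jt)\}+\sum_{k=1}^q\{C_k\cos(\beta_kt^2)+D_k\sin(\beta_kt^2)\}.$$ The data are $y(t)=\mu_{\vartheta^0}(t)+X(t)$, $t=1,2,\dots$, where $X(t)=\sum_{j=-\infty}^{\infty}a(j)e(t-j)$, the $e(t)$, $t\in\mathbb Z$, are i.i.d. random variables with mean $0$ and finite variance $\sigma^2$, and the $a(j)$ are real constants with $\sum_{j=-\infty}^{\infty}|a(j)|<\infty$. Assume that: (i) $\vartheta^0$ is an interior point of $\mathcal V$, the frequencies $\alpha^0_1,\dots,\alpha^0_p$ are distinct, and so are the frequency rates $\beta^0_1,\dots,\beta^0_q$; (ii) ${A_1^0}^2+{B_1^0}^2>\dots>{A_p^0}^2+{B_p^0}^2>0$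 and ${C_1^0}^2+{D_1^0}^2>\dots>{C_q^0}^2+{D_q^0}^2>0$; (iii) the frequency rates avoid a countable exceptional set: no $\beta_k^0$, and no $\beta_k^0+\beta_l^0$ or $\beta_k^0-\beta_l^0$ with $k\ne l$, is a rational multiple of $\pi$. For each $n\ge1$ let $\hat\vartheta_n$ be a least squares estimator, that is, almost surely a minimiser over $\mathcal V$ of $Q_n(\vartheta)=\sum_{t=1}^n(y(t)-\mu_\vartheta(t))^2$, with its components numbered so that $\hat A_j^2+\hat B_j^2$ is non-increasing in $j$ and $\hat C_k^2+\hat D_k^2$ is non-increasing in $k$ (always possible, because $Q_n$ does not change when the sinusoids, or the chirp terms, are renumbered). Then $\hat\vartheta_n\to\vartheta^0$ almost surely as $n\to\infty$. -/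

import Mathlib

open MeasureTheory ProbabilityTheory Filter

namespace ChirpLike

/-- One component `(amplitude, amplitude, frequency or frequency rate)`: `(A, B, α)` for a
sinusoid, `(C, D, β)` for a chirp term. -/
abbrev Component : Type := ℝ × ℝ × ℝ

/-- The `3(p+q)` parameters of the model with `p` sinusoids and `q` chirp terms. -/
abbrev Param (p q : ℕ) : Type := (Fin p → Component) × (Fin q → Component)

/-- The value at `u` of `A cos(ω u) + B sin(ω u)` for the component `(A, B, ω)`. -/
noncomputable def Component.wave (c : Component) (u : ℝ) : ℝ :=
  c.1 * Real.cos (c.2.2 * u) + c.2.1 * Real.sin (c.2.2 * u)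

/-- The squared amplitude `A² + B²` of the component `(A, B, ω)`. -/
def Component.power (c : Component) : ℝ := c.1 ^ 2 + c.2.1 ^ 2

/-- The noiseless signal at time `t`: sinusoids in `t`, chirp terms in `t²`. -/
noncomputable def signal {p q : ℕ} (ϑ : Param p q) (t : ℕ) : ℝ :=
  ∑ j, (ϑ.1 j).wave (t : ℝ) + ∑ k, (ϑ.2 k).wave ((t : ℝ) ^ 2)

/-- The box `[-M, M] × [-M, M] × [0, π]` for one component. -/
def componentSpace (M : ℝ) : Set Component :=
  Set.Icc (-M) M ×ˢ Set.Icc (-M) M ×ˢ Set.Icc 0 Real.pi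

/-- The parameter space, the product of `p + q` copies of the box. -/
def paramSpace (M : ℝ) (p q : ℕ) : Set (Param p q) :=
  (Set.univ.pi fun _ => componentSpace M) ×ˢ (Set.univ.pi fun _ => componentSpace M)

/-- The error sum of squares of the data `y(1), …, y(n)`. -/
noncomputable def errorSS {p q : ℕ} (y : ℕ → ℝ) (n : ℕ) (ϑ : Param p q) : ℝ :=
  ∑ t ∈ Finset.Icc 1 n, (y t - signal ϑ t) ^ 2

/-- `ϑ` is a least squares estimate from `y(1), …, y(n)`: a point of the parameter space that
minimises the error sum of squares over the whole space, its sinusoids and its chirp terms being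
numbered by non-increasing squared amplitude. The error sum of squares does not depend on the
numbering, so every minimiser can be numbered in this way. -/
structure IsLSE {p q : ℕ} (M : ℝ) (y : ℕ → ℝ) (n : ℕ) (ϑ : Param p q) : Prop where
  mem : ϑ ∈ paramSpace M p q
  isMin : ∀ ϑ' ∈ paramSpace M p q, errorSS y n ϑ ≤ errorSS y n ϑ'
  sinusoids_ordered : Antitone fun j => (ϑ.1 j).power
  chirps_ordered : Antitone fun k => (ϑ.2 k).power

/-- `X(t) = ∑_{j ∈ ℤ} a(j) e(t - j)` almost surely, with absolutely summable real `a(j)` and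
i.i.d. `e(t)` of mean `0` and variance `σ²`. -/
structure IsLinearNoise {Ω : Type*} [MeasurableSpace Ω] (P : Measure Ω) (σ : ℝ) (a : ℤ → ℝ)
    (e X : ℤ → Ω → ℝ) : Prop where
  indep : iIndepFun e P
  identDistrib : ∀ t, IdentDistrib (e t) (e 0) P P
  memLp : ∀ t, MemLp (e t) 2 P
  mean_zero : ∀ t, ∫ ω, e t ω ∂P = 0
  variance_eq : ∀ t, variance (e t) P = σ ^ 2
  summable : Summable fun j => |a j|
  hasSum : ∀ t, ∀ᵐ ω ∂P, HasSum (fun j => a j * e (t - j) ω) (X t ω)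

/-- The squared amplitudes of the components are strictly decreasing and positive. -/
def StrictlyOrdered {m : ℕ} (c : Fin m → Component) : Prop :=
  (StrictAnti fun j => (c j).power) ∧ ∀ j, 0 < (c j).power

/-- No frequency rate, and no sum or difference of two of the frequency rates, lies in the
countable set of rational multiples of `π`. -/
def NonResonant {q : ℕ} (c : Fin q → Component) : Prop :=
  (∀ k, Irrational ((c k).2.2 / Real.pi)) ∧
    ∀ k l, k ≠ l → Irrational (((c k).2.2 + (c l).2.2) / Real.pi) ∧
      Irrational (((c k).2.2 - (c l).2.2) / Real.pi)

end ChirpLike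

namespace ChirpLike

/-- A family of weight sequences that is bounded by `1` and whose `t`-th term is Lipschitz in the
parameter with constant `t²`. -/
structure IsWeightFamily (F : ℝ → ℕ → ℝ) : Prop where
  abs_le_one : ∀ θ t, |F θ t| ≤ 1
  lipschitz : ∀ θ θ' t, |F θ t - F θ' t| ≤ (t : ℝ) ^ 2 * |θ - θ'|

section Noise

variable {Ω : Type*} [MeasurableSpace Ω] {P : Measure Ω} [IsProbabilityMeasure P]

theorem measureReal_le_abs_weighted_sum_le {ξ : ℕ → Ω → ℝ} (hind : iIndepFun ξ P)
    (hm : ∀ t, AEMeasurable (ξ t) P) {b : ℝ} (hb : 0 < b) (hbd : ∀ t ω, |ξ t ω| ≤ b)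
    (h0 : ∀ t, ∫ ω, ξ t ω ∂P = 0) {w : ℕ → ℝ} (hw : ∀ t, |w t| ≤ 1) {ε : ℝ} (hε : 0 < ε) (n : ℕ) :
    P.real {ω | ε * n ≤ |∑ t ∈ Finset.Icc 1 n, w t * ξ t ω|} ≤
      2 * Real.exp (-(ε ^ 2 / (2 * b ^ 2)) * n) := by
  have key : ∀ v : ℕ → ℝ, (∀ t, |v t| ≤ 1) →
      P.real {ω | ε * n ≤ ∑ t ∈ Finset.Icc 1 n, v t * ξ t ω} ≤
        Real.exp (-(ε ^ 2 / (2 * b ^ 2)) * n) := by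
    intro v hv
    have hind' : iIndepFun (fun t ω => v t * ξ t ω) P :=
      hind.comp (fun t x => v t * x) (fun t => measurable_const_mul (v t))
    have hsub : ∀ t ∈ Finset.Icc 1 n,
        HasSubgaussianMGF (fun ω => v t * ξ t ω) ((‖b - (-b)‖₊ / 2) ^ 2) P := by
      intro t _
      refine hasSubgaussianMGF_of_mem_Icc_of_integral_eq_zero ((hm t).const_mul _) ?_ ?_
      · refine Eventually.of_forall fun ω => ?_
        rw [Set.mem_Icc, ← abs_le, abs_mul]
        calc |v t| * |ξ t ω| ≤ 1 * b :=
              mul_le_mul (hv t) (hbd t ω) (abs_nonneg _) zero_le_one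
          _ = b := one_mul b
      · simp [integral_const_mul, h0]
    have h := HasSubgaussianMGF.measure_sum_ge_le_of_iIndepFun hind' hsub
      (ε := ε * n) (by positivity)
    refine h.trans (le_of_eq ?_)
    congr 1
    have hc : (((‖b - (-b)‖₊ / 2) ^ 2 : NNReal) : ℝ) = b ^ 2 := by
      push_cast
      rw [Real.norm_eq_abs, abs_of_pos (by linarith)]
      ring
    rcases Nat.eq_zero_or_pos n with rfl | hn
    · simp
    have hn' : (0 : ℝ) < n := by exact_mod_cast hn
    simp only [Finset.sum_const, Nat.card_Icc, Nat.add_sub_cancel, nsmul_eq_mul]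
    push_cast at hc ⊢
    rw [hc]
    field_simp
  have hsplit : {ω | ε * n ≤ |∑ t ∈ Finset.Icc 1 n, w t * ξ t ω|} ⊆
      {ω | ε * n ≤ ∑ t ∈ Finset.Icc 1 n, w t * ξ t ω} ∪
        {ω | ε * n ≤ ∑ t ∈ Finset.Icc 1 n, (-w t) * ξ t ω} := by
    intro ω hω
    simp only [Set.mem_ofPred_eq, Set.mem_union, neg_mul, Finset.sum_neg_distrib] at hω ⊢
    exact le_abs.1 hω
  calc _ ≤ _ := measureReal_mono hsplit
    _ ≤ _ := measureReal_union_le _ _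
    _ ≤ _ := add_le_add (key w hw) (key (fun t => -w t) (fun t => by simpa using hw t))
    _ = _ := by ring

theorem ae_eventually_abs_weighted_sum_lt {ξ : ℕ → Ω → ℝ} (hind : iIndepFun ξ P)
    (hm : ∀ t, AEMeasurable (ξ t) P) {b : ℝ} (hb : 0 < b) (hbd : ∀ t ω, |ξ t ω| ≤ b)
    (h0 : ∀ t, ∫ ω, ξ t ω ∂P = 0) {F : ℝ → ℕ → ℝ} (hF : IsWeightFamily F) {ε : ℝ} (hε : 0 < ε) :
    ∀ᵐ ω ∂P, ∀ᶠ n : ℕ in atTop, ∀ i ≤ n ^ 3,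
      |∑ t ∈ Finset.Icc 1 n, F (i * Real.pi / n ^ 3) t * ξ t ω| < ε * n := by
  set A : ℕ → Set Ω := fun n => ⋃ i ∈ Finset.range (n ^ 3 + 1),
    {ω | ε * n ≤ |∑ t ∈ Finset.Icc 1 n, F (i * Real.pi / n ^ 3) t * ξ t ω|} with hA
  set c : ℝ := ε ^ 2 / (2 * b ^ 2) with hc
  have hcpos : 0 < c := by positivity
  have hbound : ∀ n, P.real (A n) ≤ 2 * (n ^ 3 * Real.exp (-c * n) + n ^ 0 * Real.exp (-c * n)) := by
    intro n
    calc P.real (A n) ≤ ∑ i ∈ Finset.range (n ^ 3 + 1), _ := measureReal_biUnion_finset_le _ _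
      _ ≤ ∑ i ∈ Finset.range (n ^ 3 + 1), 2 * Real.exp (-c * n) := by
          refine Finset.sum_le_sum fun i _ => ?_
          exact measureReal_le_abs_weighted_sum_le hind hm hb hbd h0 (fun t => hF.abs_le_one _ t) hε n
      _ = _ := by simp; ring
  have hsum : Summable fun n : ℕ =>
      2 * ((n : ℝ) ^ 3 * Real.exp (-c * n) + (n : ℝ) ^ 0 * Real.exp (-c * n)) :=
    ((Real.summable_pow_mul_exp_neg_nat_mul 3 hcpos).add
      (Real.summable_pow_mul_exp_neg_nat_mul 0 hcpos)).mul_left 2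
  have hne : ∑' n, P (A n) ≠ ⊤ := by
    refine ne_top_of_le_ne_top hsum.tsum_ofReal_ne_top (ENNReal.tsum_le_tsum fun n => ?_)
    rw [← ofReal_measureReal (measure_ne_top P _)]
    exact ENNReal.ofReal_le_ofReal (hbound n)
  filter_upwards [ae_eventually_notMem hne] with ω hω
  filter_upwards [hω] with n hn i hi
  by_contra hcon
  exact hn (Set.mem_biUnion (Finset.mem_coe.2 (Finset.mem_range.2 (Nat.lt_succ_of_le hi)))
    (not_lt.1 hcon))

theorem exists_grid_point {n : ℕ} (hn : 1 ≤ n) {θ : ℝ} (hθ : θ ∈ Set.Icc 0 Real.pi) :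
    ∃ i ≤ n ^ 3, |θ - i * Real.pi / n ^ 3| ≤ Real.pi / n ^ 3 := by
  have hn' : (0 : ℝ) < (n : ℝ) ^ 3 := by positivity
  have hpi := Real.pi_pos
  have hx : 0 ≤ θ * n ^ 3 / Real.pi := by have := hθ.1; positivity
  refine ⟨⌊θ * n ^ 3 / Real.pi⌋₊, ?_, ?_⟩
  · apply Nat.floor_le_of_le
    push_cast
    rw [div_le_iff₀ hpi, mul_comm]
    exact mul_le_mul_of_nonneg_left hθ.2 hn'.le
  · have h1 := Nat.floor_le hx
    have h2 := Nat.lt_floor_add_one (θ * n ^ 3 / Real.pi)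
    set m : ℝ := (⌊θ * n ^ 3 / Real.pi⌋₊ : ℝ)
    have e : θ - m * Real.pi / n ^ 3 = (θ * n ^ 3 / Real.pi - m) * (Real.pi / n ^ 3) := by
      field_simp
    rw [e, abs_of_nonneg (mul_nonneg (by linarith) (by positivity))]
    calc _ ≤ 1 * (Real.pi / (n : ℝ) ^ 3) :=
          mul_le_mul_of_nonneg_right (by linarith) (by positivity)
      _ = _ := one_mul _

theorem ae_tendsto_weighted_average_of_bounded {ξ : ℕ → Ω → ℝ} (hind : iIndepFun ξ P)
    (hm : ∀ t, AEMeasurable (ξ t) P) {b : ℝ} (hb : 0 < b) (hbd : ∀ t ω, |ξ t ω| ≤ b)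
    (h0 : ∀ t, ∫ ω, ξ t ω ∂P = 0) {F : ℝ → ℕ → ℝ} (hF : IsWeightFamily F) :
    ∀ᵐ ω ∂P, ∀ θ : ℕ → ℝ, (∀ n, θ n ∈ Set.Icc 0 Real.pi) →
      Tendsto (fun n : ℕ => (∑ t ∈ Finset.Icc 1 n, F (θ n) t * ξ t ω) / n) atTop (nhds 0) := by
  have hall : ∀ᵐ ω ∂P, ∀ k : ℕ, ∀ᶠ n : ℕ in atTop, ∀ i ≤ n ^ 3,
      |∑ t ∈ Finset.Icc 1 n, F (i * Real.pi / n ^ 3) t * ξ t ω| < 1 / (k + 1 : ℝ) * n :=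
    ae_all_iff.2 fun k =>
      ae_eventually_abs_weighted_sum_lt hind hm hb hbd h0 hF (by positivity)
  filter_upwards [hall] with ω hω θ hθ
  rw [Metric.tendsto_nhds]
  intro ε hε
  obtain ⟨k, hk⟩ := exists_nat_one_div_lt (half_pos hε)
  have hlim : Tendsto (fun n : ℕ => Real.pi * b / (n : ℝ)) atTop (nhds 0) :=
    tendsto_const_div_atTop_nhds_zero_nat _
  filter_upwards [hω k, hlim.eventually (gt_mem_nhds (half_pos hε)), eventually_ge_atTop 1]
    with n hn hsmall hn1
  have hn' : (1 : ℝ) ≤ n := by exact_mod_cast hn1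
  have hnpos : (0 : ℝ) < n := by linarith
  obtain ⟨i, hi, hdist⟩ := exists_grid_point hn1 (hθ n)
  have h1 := hn i hi
  have h2 : |∑ t ∈ Finset.Icc 1 n, (F (θ n) t - F (i * Real.pi / n ^ 3) t) * ξ t ω| ≤
      Real.pi * b := by
    calc _ ≤ ∑ t ∈ Finset.Icc 1 n, |(F (θ n) t - F (i * Real.pi / n ^ 3) t) * ξ t ω| :=
          Finset.abs_sum_le_sum_abs _ _
      _ ≤ ∑ t ∈ Finset.Icc 1 n, (n : ℝ) ^ 2 * (Real.pi / n ^ 3) * b := by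
          refine Finset.sum_le_sum fun t ht => ?_
          rw [abs_mul]
          have ht' : (t : ℝ) ≤ n := by exact_mod_cast (Finset.mem_Icc.1 ht).2
          have hpi := Real.pi_pos
          refine mul_le_mul ((hF.lipschitz _ _ t).trans ?_) (hbd t ω) (abs_nonneg _) (by positivity)
          exact mul_le_mul (by gcongr) hdist (abs_nonneg _) (by positivity)
      _ = Real.pi * b := by
          simp only [Finset.sum_const, Nat.card_Icc, Nat.add_sub_cancel, nsmul_eq_mul]
          field_simp
  have e : ∑ t ∈ Finset.Icc 1 n, F (θ n) t * ξ t ω =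
      ∑ t ∈ Finset.Icc 1 n, F (i * Real.pi / n ^ 3) t * ξ t ω +
        ∑ t ∈ Finset.Icc 1 n, (F (θ n) t - F (i * Real.pi / n ^ 3) t) * ξ t ω := by
    rw [← Finset.sum_add_distrib]
    exact Finset.sum_congr rfl fun t _ => by ring
  rw [Real.dist_eq, sub_zero, abs_div, Nat.abs_cast, div_lt_iff₀ hnpos, e]
  rw [div_lt_iff₀ hnpos] at hsmall
  have h3 : 1 / ((k : ℝ) + 1) * n ≤ ε / 2 * n := by gcongr
  calc _ ≤ _ := abs_add_le _ _
    _ < ε * n := by linarith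

end Noise

section Noise

variable {Ω : Type*} [MeasurableSpace Ω] {P : Measure Ω}

theorem sum_Icc_one_eq_sum_range (f : ℕ → ℝ) (n : ℕ) :
    ∑ t ∈ Finset.Icc 1 n, f t = ∑ i ∈ Finset.range n, f (i + 1) := by
  induction n with
  | zero => simp
  | succ n ih => rw [Finset.sum_Icc_succ_top (by omega), ih, Finset.sum_range_succ]

theorem ae_tendsto_average_of_iid {Y : ℕ → Ω → ℝ} (hint : Integrable (Y 0) P)
    (hind : iIndepFun Y P) (hid : ∀ t, IdentDistrib (Y t) (Y 0) P P) :
    ∀ᵐ ω ∂P, Tendsto (fun n : ℕ => (∑ t ∈ Finset.Icc 1 n, Y t ω) / n) atTop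
      (nhds (∫ ω, Y 0 ω ∂P)) := by
  have h := strong_law_ae_real (μ := P) (fun i => Y (i + 1)) ((hid 1).integrable_iff.2 hint)
    (fun i j hij => hind.indepFun (by simpa using hij))
    (fun i => (hid (i + 1)).trans (hid 1).symm)
  filter_upwards [h] with ω hω
  rw [← (hid 1).integral_eq]
  simpa only [sum_Icc_one_eq_sum_range] using hω

theorem exists_truncation_error_lt {f : Ω → ℝ} (hf : Integrable f P) {ε : ℝ} (hε : 0 < ε) :
    ∃ R : ℕ, ∫ ω, |f ω - truncation f R ω| ∂P < ε := by
  have hlim : Tendsto (fun R : ℕ => ∫ ω, |f ω - truncation f R ω| ∂P) atTop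
      (nhds (∫ _, (0 : ℝ) ∂P)) := by
    refine tendsto_integral_of_dominated_convergence (fun ω => 2 * |f ω|)
      (fun R => (hf.1.sub hf.1.truncation).norm) (hf.norm.const_mul 2) (fun R => ?_) ?_
    · refine Eventually.of_forall fun ω => ?_
      have h1 := abs_truncation_le_abs_self f R ω
      have h2 := abs_sub (f ω) (truncation f R ω)
      rw [Real.norm_eq_abs, abs_abs]
      linarith
    · refine Eventually.of_forall fun ω => ?_
      refine tendsto_const_nhds.congr' ?_
      filter_upwards [eventually_gt_atTop ⌈|f ω|⌉₊] with R hR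
      rw [truncation_eq_self ((Nat.le_ceil _).trans_lt (by exact_mod_cast hR))]
      simp
  rw [integral_zero] at hlim
  exact (hlim.eventually (gt_mem_nhds hε)).exists

theorem ae_eventually_abs_weighted_average_lt [IsProbabilityMeasure P]
    {e : ℕ → Ω → ℝ} (hint : Integrable (e 0) P)
    (hind : iIndepFun e P) (hid : ∀ t, IdentDistrib (e t) (e 0) P P)
    (h0 : ∫ ω, e 0 ω ∂P = 0) {F : ℝ → ℕ → ℝ} (hF : IsWeightFamily F) {ε : ℝ} (hε : 0 < ε) :
    ∀ᵐ ω ∂P, ∀ θ : ℕ → ℝ, (∀ n, θ n ∈ Set.Icc 0 Real.pi) →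
      ∀ᶠ n : ℕ in atTop, |(∑ t ∈ Finset.Icc 1 n, F (θ n) t * e t ω) / n| < ε := by
  obtain ⟨R, hR⟩ := exists_truncation_error_lt hint (show 0 < ε / 4 by positivity)
  set g : ℝ → ℝ := Set.indicator (Set.Ioc (-(R : ℝ)) R) id with hg
  have hgm : Measurable g := measurable_id.indicator measurableSet_Ioc
  have htr : ∀ t, truncation (e t) R = g ∘ e t := fun t => rfl
  set c : ℝ := ∫ ω, g (e 0 ω) ∂P with hc
  have hem : ∀ t, AEMeasurable (e t) P := fun t => (hid t).aemeasurable_fst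
  have hgle : ∀ x, |g x| ≤ R := by
    intro x
    have := abs_truncation_le_bound (id : ℝ → ℝ) R x
    rwa [Nat.abs_cast] at this
  have hgint : Integrable (fun ω => g (e 0 ω)) P := hint.1.integrable_truncation
  have hcabs : |c| ≤ ε / 4 := by
    have : c = -∫ ω, (e 0 ω - truncation (e 0) R ω) ∂P := by
      rw [integral_sub hint hint.1.integrable_truncation, h0, hc, htr]; simp [Function.comp]
    rw [this, abs_neg]
    exact (abs_integral_le_integral_abs).trans hR.le
  -- the bounded part
  have hbdd := ae_tendsto_weighted_average_of_bounded (P := P) (ξ := fun t ω => g (e t ω) - c)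
    (b := R + ε) (hind.comp (fun _ x => g x - c) (fun _ => hgm.sub_const c))
    (fun t => (hgm.comp_aemeasurable (hem t)).sub_const c) (by positivity)
    (fun t ω => by
      have h1 := hgle (e t ω)
      have h2 := abs_sub (g (e t ω)) c
      linarith)
    (fun t => by
      have hgi : Integrable (fun ω => g (e t ω)) P :=
        (((hid t).comp hgm).integrable_iff).2 hgint
      have hgc : ∫ ω, g (e t ω) ∂P = c := ((hid t).comp hgm).integral_eq
      rw [integral_sub hgi (integrable_const c), hgc]
      simp) hF
  -- the remainder
  have hrm : Measurable fun x : ℝ => |x - (g x - c)| :=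
    (measurable_id.sub (hgm.sub_const c)).abs
  have hrint : Integrable (fun ω => |e 0 ω - (g (e 0 ω) - c)|) P :=
    (hint.sub (hgint.sub (integrable_const c))).abs
  have hrem := ae_tendsto_average_of_iid (P := P) (Y := fun t ω => |e t ω - (g (e t ω) - c)|)
    hrint (hind.comp (fun _ x => |x - (g x - c)|) (fun _ => hrm)) (fun t => (hid t).comp hrm)
  have hmean : ∫ ω, |e 0 ω - (g (e 0 ω) - c)| ∂P < ε * (3 / 4) := by
    have h1 : ∫ ω, |e 0 ω - (g (e 0 ω) - c)| ∂P ≤ ∫ ω, (|e 0 ω - g (e 0 ω)| + |c|) ∂P := by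
      refine integral_mono hrint ((hint.sub hgint).abs.add (integrable_const _)) fun ω => ?_
      have : e 0 ω - (g (e 0 ω) - c) = (e 0 ω - g (e 0 ω)) + c := by ring
      simp only [this]
      exact abs_add_le _ _
    have hi : Integrable (fun ω => |e 0 ω - g (e 0 ω)|) P := (hint.sub hgint).abs
    rw [integral_add hi (integrable_const _)] at h1
    have h2 : ∫ ω, |e 0 ω - g (e 0 ω)| ∂P < ε / 4 := hR
    simp only [integral_const, probReal_univ, one_smul] at h1
    linarith
  filter_upwards [hbdd, hrem] with ω hω1 hω2 θ hθ
  have hA := (Metric.tendsto_nhds.1 (hω1 θ hθ)) (ε / 4) (by positivity)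
  filter_upwards [hA, hω2.eventually (gt_mem_nhds hmean), eventually_ge_atTop 1] with n hn1 hn2 hn
  have hnpos : (0 : ℝ) < n := by exact_mod_cast hn
  rw [Real.dist_eq, sub_zero] at hn1
  have hsplit : (∑ t ∈ Finset.Icc 1 n, F (θ n) t * e t ω) / n =
      (∑ t ∈ Finset.Icc 1 n, F (θ n) t * (g (e t ω) - c)) / n +
        (∑ t ∈ Finset.Icc 1 n, F (θ n) t * (e t ω - (g (e t ω) - c))) / n := by
    rw [← add_div, ← Finset.sum_add_distrib]
    congr 1
    exact Finset.sum_congr rfl fun t _ => by ring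
  have hB : |(∑ t ∈ Finset.Icc 1 n, F (θ n) t * (e t ω - (g (e t ω) - c))) / n| ≤
      (∑ t ∈ Finset.Icc 1 n, |e t ω - (g (e t ω) - c)|) / n := by
    rw [abs_div, Nat.abs_cast]
    gcongr
    refine (Finset.abs_sum_le_sum_abs _ _).trans (Finset.sum_le_sum fun t _ => ?_)
    rw [abs_mul]
    exact mul_le_of_le_one_left (abs_nonneg _) (hF.abs_le_one _ _)
  rw [hsplit]
  calc _ ≤ _ := abs_add_le _ _
    _ < ε := by linarith

theorem ae_tendsto_weighted_average_of_iid [IsProbabilityMeasure P]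
    {e : ℕ → Ω → ℝ} (hint : Integrable (e 0) P)
    (hind : iIndepFun e P) (hid : ∀ t, IdentDistrib (e t) (e 0) P P)
    (h0 : ∫ ω, e 0 ω ∂P = 0) {F : ℝ → ℕ → ℝ} (hF : IsWeightFamily F) :
    ∀ᵐ ω ∂P, ∀ θ : ℕ → ℝ, (∀ n, θ n ∈ Set.Icc 0 Real.pi) →
      Tendsto (fun n : ℕ => (∑ t ∈ Finset.Icc 1 n, F (θ n) t * e t ω) / n) atTop (nhds 0) := by
  have hall := ae_all_iff.2 fun k : ℕ => ae_eventually_abs_weighted_average_lt hint hind hid h0 hF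
    (show 0 < 1 / (k + 1 : ℝ) by positivity)
  filter_upwards [hall] with ω hω θ hθ
  rw [Metric.tendsto_nhds]
  intro ε hε
  obtain ⟨k, hk⟩ := exists_nat_one_div_lt hε
  filter_upwards [hω k θ hθ] with n hn
  rw [Real.dist_eq, sub_zero]
  exact hn.trans hk

/-- A weak maximal inequality for the averages of independent nonnegative variables. -/
theorem exists_average_bound [IsProbabilityMeasure P] {Y : ℕ → Ω → ℝ}
    (hnn : ∀ t ω, 0 ≤ Y t ω)
    (hL2 : ∀ t, MemLp (Y t) 2 P) (hind : iIndepFun Y P) {m v : ℝ}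
    (hmean : ∀ t, ∫ ω, Y t ω ∂P = m) (hvar : ∀ t, variance (Y t) P = v) :
    ∃ B : Ω → ENNReal, AEMeasurable B P ∧
      (∀ ω, ∀ n : ℕ, 1 ≤ n → ENNReal.ofReal ((∑ t ∈ Finset.Icc 1 n, Y t ω) / n) ≤ B ω) ∧
      ∫⁻ ω, B ω ∂P ≤ ENNReal.ofReal (2 * m + 2) + 2 * ∑' k : ℕ, ENNReal.ofReal (v / 2 ^ k) := by
  set Z : ℕ → Ω → ℝ := fun k ω => (∑ t ∈ Finset.Icc 1 (2 ^ k), Y t ω) / 2 ^ k with hZ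
  have hZL2 : ∀ k, MemLp (Z k) 2 P := fun k => by
    have := (memLp_finsetSum (Finset.Icc 1 (2 ^ k)) fun t _ => hL2 t).mul_const ((2 ^ k : ℝ)⁻¹)
    simpa only [hZ, div_eq_mul_inv] using this
  have hZmean : ∀ k, ∫ ω, Z k ω ∂P = m := fun k => by
    simp only [hZ]
    rw [integral_div, integral_finsetSum _ fun t _ => (hL2 t).integrable (by norm_num)]
    simp [hmean]
  have hZvar : ∀ k, variance (Z k) P = v / 2 ^ k := fun k => by
    have h1 : Z k = fun ω => (2 ^ k : ℝ)⁻¹ * (∑ t ∈ Finset.Icc 1 (2 ^ k), Y t) ω := by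
      funext ω
      simp only [hZ, Finset.sum_apply, div_eq_inv_mul]
    rw [h1, variance_const_mul, IndepFun.variance_sum (fun t _ => hL2 t)
      (fun i _ j _ hij => hind.indepFun hij)]
    simp only [hvar, Finset.sum_const, Nat.card_Icc, Nat.add_sub_cancel, nsmul_eq_mul]
    push_cast
    field_simp
  have hm0 : 0 ≤ m := by
    rw [← hmean 0]; exact integral_nonneg (hnn 0)
  have hmeas : ∀ k, AEMeasurable (fun ω => ENNReal.ofReal ((Z k ω - m) ^ 2)) P := fun k =>
    (((hZL2 k).aemeasurable.sub_const m).pow_const 2).ennreal_ofReal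
  refine ⟨fun ω => ENNReal.ofReal (2 * m + 2) + 2 * ∑' k, ENNReal.ofReal ((Z k ω - m) ^ 2),
    ?_, ?_, ?_⟩
  · exact ((AEMeasurable.tsum hmeas).const_mul 2).const_add _
  · intro ω n hn
    set k := Nat.log 2 n with hk
    have h1 : 2 ^ k ≤ n := Nat.pow_log_le_self 2 (by omega)
    have h2 : n < 2 ^ (k + 1) := Nat.lt_pow_succ_log_self (by norm_num) n
    have hle : (∑ t ∈ Finset.Icc 1 n, Y t ω) / n ≤ 2 * Z (k + 1) ω := by
      have ha : ∑ t ∈ Finset.Icc 1 n, Y t ω ≤ ∑ t ∈ Finset.Icc 1 (2 ^ (k + 1)), Y t ω :=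
        Finset.sum_le_sum_of_subset_of_nonneg (Finset.Icc_subset_Icc_right h2.le)
          fun t _ _ => hnn t ω
      have h1' : (2 : ℝ) ^ k ≤ n := by exact_mod_cast h1
      have hnn' : 0 ≤ ∑ t ∈ Finset.Icc 1 (2 ^ (k + 1)), Y t ω :=
        Finset.sum_nonneg fun t _ => hnn t ω
      calc _ ≤ (∑ t ∈ Finset.Icc 1 (2 ^ (k + 1)), Y t ω) / 2 ^ k := by gcongr
        _ = _ := by simp only [hZ]; field_simp; ring
    have hle2 : (∑ t ∈ Finset.Icc 1 n, Y t ω) / n ≤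
        (2 * m + 2) + 2 * (Z (k + 1) ω - m) ^ 2 := by
      nlinarith [sq_nonneg (Z (k + 1) ω - m - 1), sq_nonneg (Z (k + 1) ω - m)]
    calc _ ≤ ENNReal.ofReal ((2 * m + 2) + 2 * (Z (k + 1) ω - m) ^ 2) :=
          ENNReal.ofReal_le_ofReal hle2
      _ = ENNReal.ofReal (2 * m + 2) + 2 * ENNReal.ofReal ((Z (k + 1) ω - m) ^ 2) := by
          rw [ENNReal.ofReal_add (by positivity) (by positivity),
            ENNReal.ofReal_mul (by norm_num)]
          norm_num
      _ ≤ _ := by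
          refine add_le_add le_rfl (mul_le_mul' le_rfl ?_)
          exact ENNReal.le_tsum (f := fun k => ENNReal.ofReal ((Z k ω - m) ^ 2)) (k + 1)
  · rw [lintegral_add_left measurable_const, lintegral_const_mul'' _
      (AEMeasurable.tsum hmeas), lintegral_tsum hmeas]
    simp only [lintegral_const, measure_univ, mul_one]
    gcongr with k
    rw [← hZvar k, variance_eq_integral (hZL2 k).aemeasurable, hZmean k]
    rw [ofReal_integral_eq_lintegral_ofReal]
    · exact (MemLp.sub (hZL2 k) (memLp_const m)).integrable_sq
    · exact Eventually.of_forall fun ω => sq_nonneg _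

end Noise

section Noise

variable {Ω : Type*} [MeasurableSpace Ω] {P : Measure Ω}

theorem tsum_ofReal_div_two_pow_ne_top {v : ℝ} :
    ∑' k : ℕ, ENNReal.ofReal (v / 2 ^ k) ≠ ⊤ := by
  have h : Summable fun k : ℕ => v / 2 ^ k := by
    simpa [div_eq_mul_inv] using summable_geometric_two.mul_left v
  exact h.tsum_ofReal_ne_top

theorem ae_exists_summable_average_bound [IsProbabilityMeasure P] {σ : ℝ} {a : ℤ → ℝ}
    {e X : ℤ → Ω → ℝ} (hX : IsLinearNoise P σ a e X) :
    ∀ᵐ ω ∂P, ∃ b : ℤ → ℝ, Summable b ∧ ∀ j, ∀ n : ℕ, 1 ≤ n →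
      |a j| * ((∑ t ∈ Finset.Icc 1 n, |e (t - j) ω|) / n) ≤ b j := by
  have hid : ∀ t, IdentDistrib (fun ω => |e t ω|) (fun ω => |e 0 ω|) P P := fun t =>
    (hX.identDistrib t).comp measurable_id.abs
  set m : ℝ := ∫ ω, |e 0 ω| ∂P
  set v : ℝ := variance (fun ω => |e 0 ω|) P
  have hex : ∀ j : ℤ, _ := fun j =>
    exists_average_bound (P := P) (Y := fun (t : ℕ) ω => |e (t - j) ω|) (m := m) (v := v)
      (fun t ω => abs_nonneg _) (fun t => (hX.memLp _).abs)
      ((hX.indep.comp (fun _ x => |x|) (fun _ => measurable_id.abs)).precomp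
        (g := fun t : ℕ => (t : ℤ) - j) (fun s t h => by simpa using h))
      (fun t => (hid _).integral_eq) (fun t => (hid _).variance_eq)
  choose B hBm hBle hBint using hex
  set C : ENNReal := ENNReal.ofReal (2 * m + 2) + 2 * ∑' k : ℕ, ENNReal.ofReal (v / 2 ^ k)
  have hC : C ≠ ⊤ := ENNReal.add_ne_top.2 ⟨ENNReal.ofReal_ne_top,
    ENNReal.mul_ne_top (by norm_num) tsum_ofReal_div_two_pow_ne_top⟩
  have hmeas : ∀ j, AEMeasurable (fun ω => ENNReal.ofReal |a j| * B j ω) P := fun j =>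
    (hBm j).const_mul _
  have hfin : ∫⁻ ω, ∑' j, ENNReal.ofReal |a j| * B j ω ∂P ≠ ⊤ := by
    rw [lintegral_tsum hmeas]
    refine ne_top_of_le_ne_top (ENNReal.mul_ne_top hX.summable.tsum_ofReal_ne_top hC) ?_
    rw [← ENNReal.tsum_mul_right]
    refine ENNReal.tsum_le_tsum fun j => ?_
    rw [lintegral_const_mul'' _ (hBm j)]
    exact mul_le_mul' le_rfl (hBint j)
  filter_upwards [ae_lt_top' (AEMeasurable.tsum hmeas) hfin] with ω hω
  refine ⟨fun j => (ENNReal.ofReal |a j| * B j ω).toReal, ENNReal.summable_toReal hω.ne, ?_⟩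
  intro j n hn
  have hj : ENNReal.ofReal |a j| * B j ω ≠ ⊤ := ENNReal.ne_top_of_tsum_ne_top hω.ne j
  rw [← ENNReal.ofReal_le_iff_le_toReal hj, ENNReal.ofReal_mul (abs_nonneg _)]
  exact mul_le_mul' le_rfl (hBle j ω n hn)

/-- The weighted averages of a linear process vanish in the limit, uniformly over a weight
family. -/
theorem IsLinearNoise.ae_tendsto_weighted_average [IsProbabilityMeasure P] {σ : ℝ} {a : ℤ → ℝ}
    {e X : ℤ → Ω → ℝ} (hX : IsLinearNoise P σ a e X) {F : ℝ → ℕ → ℝ} (hF : IsWeightFamily F) :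
    ∀ᵐ ω ∂P, ∀ θ : ℕ → ℝ, (∀ n, θ n ∈ Set.Icc 0 Real.pi) →
      Tendsto (fun n : ℕ => (∑ t ∈ Finset.Icc 1 n, F (θ n) t * X t ω) / n) atTop (nhds 0) := by
  have hall : ∀ᵐ ω ∂P, ∀ j : ℤ, ∀ θ : ℕ → ℝ, (∀ n, θ n ∈ Set.Icc 0 Real.pi) →
      Tendsto (fun n : ℕ => (∑ t ∈ Finset.Icc 1 n, F (θ n) t * e (t - j) ω) / n) atTop
        (nhds 0) := by
    refine ae_all_iff.2 fun j => ?_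
    have hid : ∀ t : ℕ, IdentDistrib (e (t - j)) (e ((0 : ℕ) - j)) P P := fun t =>
      (hX.identDistrib _).trans (hX.identDistrib _).symm
    exact ae_tendsto_weighted_average_of_iid (e := fun t : ℕ => e (t - j))
      ((hX.memLp _).integrable (by norm_num))
      (hX.indep.precomp (g := fun t : ℕ => (t : ℤ) - j) (fun s t h => by simpa using h))
      hid (hX.mean_zero _) hF
  filter_upwards [hall, ae_exists_summable_average_bound hX, ae_all_iff.2 hX.hasSum]
    with ω hω ⟨b, hb, hbound⟩ hsum θ hθ
  have hrepr : ∀ n : ℕ, (∑ t ∈ Finset.Icc 1 n, F (θ n) t * X t ω) / n =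
      ∑' j, a j * ((∑ t ∈ Finset.Icc 1 n, F (θ n) t * e (t - j) ω) / n) := by
    intro n
    have h1 : HasSum (fun j => ∑ t ∈ Finset.Icc 1 n, F (θ n) t * (a j * e (t - j) ω))
        (∑ t ∈ Finset.Icc 1 n, F (θ n) t * X t ω) :=
      hasSum_sum fun t _ => (hsum t).mul_left _
    rw [← (h1.div_const (n : ℝ)).tsum_eq]
    refine tsum_congr fun j => ?_
    rw [← mul_div_assoc, Finset.mul_sum]
    congr 1
    exact Finset.sum_congr rfl fun t _ => by ring
  simp only [hrepr]
  have h := tendsto_tsum_of_dominated_convergence (𝓕 := atTop)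
    (f := fun n j => a j * ((∑ t ∈ Finset.Icc 1 n, F (θ n) t * e (t - j) ω) / (n : ℝ)))
    (g := fun _ => (0 : ℝ)) hb (fun j => by simpa using (hω j θ hθ).const_mul (a j)) (by
      filter_upwards [eventually_ge_atTop 1] with n hn j
      refine le_trans ?_ (hbound j n hn)
      rw [Real.norm_eq_abs, abs_mul, abs_div, Nat.abs_cast]
      gcongr
      refine (Finset.abs_sum_le_sum_abs _ _).trans (Finset.sum_le_sum fun t _ => ?_)
      rw [abs_mul]
      exact mul_le_of_le_one_left (abs_nonneg _) (hF.abs_le_one _ _))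
  simpa using h

end Noise

theorem abs_cos_sub_cos_le (x y : ℝ) : |Real.cos x - Real.cos y| ≤ |x - y| := by
  rw [Real.cos_sub_cos, abs_mul, abs_mul]
  have h1 := Real.abs_sin_le_one ((x + y) / 2)
  have h2 : |Real.sin ((x - y) / 2)| ≤ |(x - y) / 2| := Real.abs_sin_le_abs
  rw [abs_div, abs_two] at h2
  norm_num
  nlinarith [abs_nonneg (Real.sin ((x - y) / 2)), abs_nonneg (x - y)]

theorem abs_sin_sub_sin_le (x y : ℝ) : |Real.sin x - Real.sin y| ≤ |x - y| := by
  have h := abs_cos_sub_cos_le (Real.pi / 2 - x) (Real.pi / 2 - y)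
  rw [Real.cos_pi_div_two_sub, Real.cos_pi_div_two_sub] at h
  rwa [sub_sub_sub_cancel_left, abs_sub_comm y x] at h

theorem natCast_pow_le_sq {d : ℕ} (hd : d ∈ Set.Icc 1 2) (t : ℕ) : (t : ℝ) ^ d ≤ (t : ℝ) ^ 2 := by
  rcases Nat.eq_zero_or_pos t with rfl | ht
  · have : d ≠ 0 := by have := hd.1; omega
    simp [this]
  · exact pow_le_pow_right₀ (by exact_mod_cast ht) hd.2

theorem isWeightFamily_comp_mul_pow {f : ℝ → ℝ} (hf1 : ∀ x, |f x| ≤ 1)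
    (hf : ∀ x y, |f x - f y| ≤ |x - y|) {d : ℕ} (hd : d ∈ Set.Icc 1 2) :
    IsWeightFamily fun θ t => f (θ * (t : ℝ) ^ d) where
  abs_le_one _ _ := hf1 _
  lipschitz θ θ' t := by
    refine (hf _ _).trans ?_
    rw [← sub_mul, abs_mul, mul_comm, abs_of_nonneg (by positivity : (0 : ℝ) ≤ (t : ℝ) ^ d)]
    exact mul_le_mul_of_nonneg_right (natCast_pow_le_sq hd t) (abs_nonneg _)

section Average

variable {K : Type*} [Field K]

/-- The average `(f(1) + ⋯ + f(n)) / n`. -/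
def average (n : ℕ) (f : ℕ → K) : K := (∑ t ∈ Finset.Icc 1 n, f t) / n

theorem average_congr {n : ℕ} {f g : ℕ → K} (h : ∀ t, f t = g t) : average n f = average n g := by
  rw [funext h]

theorem average_add (n : ℕ) (f g : ℕ → K) :
    average n (fun t => f t + g t) = average n f + average n g := by
  simp [average, Finset.sum_add_distrib, add_div]

theorem average_sub (n : ℕ) (f g : ℕ → K) :
    average n (fun t => f t - g t) = average n f - average n g := by
  simp [average, Finset.sum_sub_distrib, sub_div]

theorem average_const_mul (n : ℕ) (c : K) (f : ℕ → K) :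
    average n (fun t => c * f t) = c * average n f := by
  simp [average, ← Finset.mul_sum, mul_div_assoc]

theorem average_sum {ι : Type*} (s : Finset ι) (n : ℕ) (f : ι → ℕ → K) :
    average n (fun t => ∑ i ∈ s, f i t) = ∑ i ∈ s, average n (f i) := by
  simp only [average]
  rw [Finset.sum_comm, Finset.sum_div]

theorem average_const [CharZero K] {n : ℕ} (hn : 1 ≤ n) (c : K) :
    average n (fun _ => c) = c := by
  have : (n : K) ≠ 0 := by exact_mod_cast (by omega : n ≠ 0)
  simp [average, this]

end Average

theorem average_nonneg {n : ℕ} {f : ℕ → ℝ} (hf : ∀ t, 0 ≤ f t) : 0 ≤ average n f :=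
  div_nonneg (Finset.sum_nonneg fun t _ => hf t) (Nat.cast_nonneg n)

theorem average_mono {n : ℕ} {f g : ℕ → ℝ} (h : ∀ t, f t ≤ g t) : average n f ≤ average n g :=
  div_le_div_of_nonneg_right (Finset.sum_le_sum fun t _ => h t) (Nat.cast_nonneg n)

theorem re_average (n : ℕ) (f : ℕ → ℂ) : (average n f).re = average n fun t => (f t).re := by
  simp only [average]
  rw [Complex.div_natCast_re, Complex.re_sum]

theorem ofReal_average (n : ℕ) (f : ℕ → ℝ) :
    ((average n f : ℝ) : ℂ) = average n fun t => (f t : ℂ) := by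
  simp [average]

theorem conj_average (n : ℕ) (f : ℕ → ℂ) :
    (starRingEnd ℂ) (average n f) = average n fun t => (starRingEnd ℂ) (f t) := by
  simp [average]

theorem sq_average_mul_le (n : ℕ) (f g : ℕ → ℝ) :
    average n (fun t => f t * g t) ^ 2 ≤
      average n (fun t => f t ^ 2) * average n fun t => g t ^ 2 := by
  simp only [average]
  rw [div_pow, div_mul_div_comm, ← pow_two]
  exact div_le_div_of_nonneg_right (Finset.sum_mul_sq_le_sq_mul_sq _ _ _) (by positivity)

theorem norm_average_le (n : ℕ) (f : ℕ → ℂ) : ‖average n f‖ ≤ average n fun t => ‖f t‖ := by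
  simp only [average]
  rw [norm_div, Complex.norm_natCast]
  exact div_le_div_of_nonneg_right (norm_sum_le _ _) (Nat.cast_nonneg n)

theorem norm_average_sq_le {n : ℕ} (hn : 1 ≤ n) (f : ℕ → ℂ) :
    ‖average n f‖ ^ 2 ≤ average n fun t => ‖f t‖ ^ 2 := by
  have h := sq_average_mul_le n (fun t => ‖f t‖) fun _ => 1
  simp only [mul_one, one_pow, average_const hn] at h
  exact (pow_le_pow_left₀ (norm_nonneg _) (norm_average_le n f) 2).trans h

/-- The point `e^{ix}` of the unit circle. -/
noncomputable def cis (x : ℝ) : ℂ := Complex.exp (x * Complex.I)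

theorem cis_add (x y : ℝ) : cis (x + y) = cis x * cis y := by
  simp [cis, add_mul, Complex.exp_add]

theorem norm_cis (x : ℝ) : ‖cis x‖ = 1 := Complex.norm_exp_ofReal_mul_I x

theorem cis_ne_zero (x : ℝ) : cis x ≠ 0 := Complex.exp_ne_zero _

theorem conj_cis (x : ℝ) : (starRingEnd ℂ) (cis x) = cis (-x) := by
  simp [cis, ← Complex.exp_conj]

theorem cis_sub (x y : ℝ) : cis (x - y) = cis x * (starRingEnd ℂ) (cis y) := by
  rw [sub_eq_add_neg, cis_add, conj_cis]

theorem cis_natCast_mul (k : ℕ) (x : ℝ) : cis (k * x) = cis x ^ k := by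
  simp [cis, ← Complex.exp_nat_mul, mul_assoc]

theorem continuous_cis : Continuous cis := by
  unfold cis; fun_prop

theorem re_cis (x : ℝ) : (cis x).re = Real.cos x := Complex.exp_ofReal_mul_I_re x

theorem im_cis (x : ℝ) : (cis x).im = Real.sin x := Complex.exp_ofReal_mul_I_im x

theorem cis_eq_one_iff (x : ℝ) : cis x = 1 ↔ ∃ k : ℤ, x = k * (2 * Real.pi) := by
  rw [cis, Complex.exp_eq_one_iff]
  refine exists_congr fun k => ?_
  rw [← mul_assoc, mul_left_inj' Complex.I_ne_zero]
  constructor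
  · intro h; exact_mod_cast h
  · intro h; rw [h]; push_cast; ring

theorem cis_ne_one_of_irrational {γ : ℝ} (h : Irrational (γ / Real.pi)) {r : ℤ} (hr : r ≠ 0) :
    cis (r * γ) ≠ 1 := by
  intro h1
  obtain ⟨k, hk⟩ := (cis_eq_one_iff _).1 h1
  refine h ⟨2 * k / r, ?_⟩
  have hr' : (r : ℝ) ≠ 0 := by exact_mod_cast hr
  push_cast
  have := Real.pi_ne_zero
  field_simp
  linarith

theorem norm_average_cis_linear_le {n : ℕ} {u : ℝ} (hu : cis u ≠ 1) (c : ℝ) :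
    ‖average n fun t => cis (u * t + c)‖ ≤ 2 / ‖cis u - 1‖ / n := by
  have htel : (cis u - 1) * ∑ t ∈ Finset.Icc 1 n, cis (u * t + c) =
      cis (u * (n + 1 : ℕ) + c) - cis (u + c) := by
    induction n with
    | zero => simp
    | succ n ih =>
      rw [Finset.sum_Icc_succ_top (by omega), mul_add, ih, sub_mul, ← cis_add,
        show u + (u * ((n + 1 : ℕ) : ℝ) + c) = u * ((n + 1 + 1 : ℕ) : ℝ) + c by push_cast; ring]
      ring
  have hpos : 0 < ‖cis u - 1‖ := norm_pos_iff.2 (sub_ne_zero.2 hu)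
  rw [average, norm_div, Complex.norm_natCast]
  refine div_le_div_of_nonneg_right ?_ (Nat.cast_nonneg n)
  rw [le_div_iff₀ hpos, mul_comm, ← norm_mul, htel]
  refine (norm_sub_le _ _).trans ?_
  rw [norm_cis, norm_cis]; norm_num

theorem tendsto_average_cis_linear {L : Filter ℕ} (hL : L ≤ atTop) {u c : ℕ → ℝ} {v : ℝ}
    (hu : Tendsto u L (nhds v)) (hv : cis v ≠ 1) :
    Tendsto (fun n => average n fun t => cis (u n * t + c n)) L (nhds 0) := by
  have hc : Tendsto (fun n => cis (u n)) L (nhds (cis v)) :=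
    (continuous_cis.tendsto v).comp hu
  have hlim : Tendsto (fun n : ℕ => 2 / ‖cis (u n) - 1‖ / n) L (nhds 0) := by
    have h1 : Tendsto (fun n => 2 / ‖cis (u n) - 1‖) L (nhds (2 / ‖cis v - 1‖)) :=
      tendsto_const_nhds.div (hc.sub_const 1).norm (norm_ne_zero_iff.2 (sub_ne_zero.2 hv))
    have h2 : Tendsto (fun n : ℕ => ((n : ℝ))⁻¹) L (nhds 0) :=
      (tendsto_inv_atTop_nhds_zero_nat (𝕜 := ℝ)).mono_left hL
    simpa [div_eq_mul_inv] using h1.mul h2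
  refine squeeze_zero_norm' ?_ hlim
  filter_upwards [hc.eventually_ne hv] with n hn
  exact norm_average_cis_linear_le hn (c n)

theorem norm_sum_shift_sub_le {f : ℕ → ℂ} (hf : ∀ t, ‖f t‖ ≤ 1) (n h : ℕ) :
    ‖∑ t ∈ Finset.Icc 1 n, f (t + h) - ∑ t ∈ Finset.Icc 1 n, f t‖ ≤ 2 * h := by
  induction h with
  | zero => simp
  | succ h ih =>
    have e : ∑ t ∈ Finset.Icc 1 n, f (t + (h + 1)) - ∑ t ∈ Finset.Icc 1 n, f (t + h) =
        f (n + 1 + h) - f (1 + h) := by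
      clear ih
      induction n with
      | zero => simp
      | succ n ih =>
        rw [Finset.sum_Icc_succ_top (by omega), Finset.sum_Icc_succ_top (by omega),
          add_sub_add_comm, ih, show n + 1 + (h + 1) = n + 1 + 1 + h by ring]
        ring
    have e2 : ‖f (n + 1 + h) - f (1 + h)‖ ≤ 2 := by
      refine (norm_sub_le _ _).trans ?_
      linarith [hf (n + 1 + h), hf (1 + h)]
    calc _ = ‖(∑ t ∈ Finset.Icc 1 n, f (t + (h + 1)) - ∑ t ∈ Finset.Icc 1 n, f (t + h)) +
          (∑ t ∈ Finset.Icc 1 n, f (t + h) - ∑ t ∈ Finset.Icc 1 n, f t)‖ := by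
          rw [sub_add_sub_cancel]
      _ ≤ 2 + 2 * h := (norm_add_le _ _).trans (add_le_add (e ▸ e2) ih)
      _ = _ := by push_cast; ring

/-- Averaging a bounded sequence over `H` consecutive shifts changes its average by `O(H / n)`. -/
theorem norm_average_sub_average_shift_le {f : ℕ → ℂ} (hf : ∀ t, ‖f t‖ ≤ 1) (n : ℕ) {H : ℕ}
    (hH : 1 ≤ H) :
    ‖average n (fun t => (H : ℂ)⁻¹ * ∑ h ∈ Finset.range H, f (t + h)) - average n f‖ ≤
      2 * H / n := by
  have hH' : (H : ℂ) ≠ 0 := by exact_mod_cast (by omega : H ≠ 0)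
  have e : average n (fun t => (H : ℂ)⁻¹ * ∑ h ∈ Finset.range H, f (t + h)) - average n f =
      (H : ℂ)⁻¹ * ∑ h ∈ Finset.range H,
        (∑ t ∈ Finset.Icc 1 n, f (t + h) - ∑ t ∈ Finset.Icc 1 n, f t) / n := by
    rw [average_const_mul, average_sum]
    simp only [average, sub_div]
    rw [Finset.sum_sub_distrib, mul_sub]
    congr 1
    simp [hH']
  rw [e, norm_mul, norm_inv, Complex.norm_natCast]
  have hHr : (0 : ℝ) < H := by exact_mod_cast hH
  have : ‖∑ h ∈ Finset.range H,
      (∑ t ∈ Finset.Icc 1 n, f (t + h) - ∑ t ∈ Finset.Icc 1 n, f t) / (n : ℂ)‖ ≤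
      H * (2 * H / n) := by
    refine (norm_sum_le _ _).trans ?_
    rw [← nsmul_eq_mul]
    nth_rewrite 2 [← Finset.card_range H]
    refine Finset.sum_le_card_nsmul _ _ _ fun h hh => ?_
    rw [norm_div, Complex.norm_natCast]
    refine div_le_div_of_nonneg_right ((norm_sum_shift_sub_le hf n h).trans ?_) (Nat.cast_nonneg n)
    have : (h : ℝ) ≤ H := by exact_mod_cast (Finset.mem_range.1 hh).le
    linarith
  calc _ ≤ (H : ℝ)⁻¹ * (H * (2 * H / n)) := by gcongr
    _ = _ := by field_simp

theorem average_normSq_shift_eq (n H : ℕ) (f : ℕ → ℂ) :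
    ((average n (fun t => ‖(H : ℂ)⁻¹ * ∑ h ∈ Finset.range H, f (t + h)‖ ^ 2) : ℝ) : ℂ) =
      ∑ h ∈ Finset.range H, ∑ k ∈ Finset.range H,
        ((H : ℂ)⁻¹ * (H : ℂ)⁻¹) * average n fun t => f (t + h) * (starRingEnd ℂ) (f (t + k)) := by
  rw [ofReal_average]
  simp_rw [← average_const_mul, ← average_sum]
  refine average_congr fun t => ?_
  push_cast
  rw [← Complex.mul_conj']
  simp only [map_mul, map_inv₀, map_natCast, map_sum]
  rw [mul_mul_mul_comm, Finset.sum_mul_sum, Finset.mul_sum]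
  simp_rw [Finset.mul_sum]

/-- Weyl's bound in qualitative form, uniform in a converging leading coefficient. -/
theorem tendsto_average_cis_quadratic {L : Filter ℕ} (hL : L ≤ atTop) {γ u : ℕ → ℝ} {g : ℝ}
    (hγ : Tendsto γ L (nhds g)) (hg : Irrational (g / Real.pi)) :
    Tendsto (fun n => average n fun t => cis (γ n * (t : ℝ) ^ 2 + u n * t)) L (nhds 0) := by
  rw [Metric.tendsto_nhds]
  intro ε hε
  obtain ⟨H, hH⟩ := exists_nat_one_div_lt (show 0 < (ε / 2) ^ 2 by positivity)
  set f : ℕ → ℕ → ℂ := fun n t => cis (γ n * (t : ℝ) ^ 2 + u n * t) with hf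
  have hHc : ((H + 1 : ℕ) : ℂ) ≠ 0 := by exact_mod_cast (by omega : H + 1 ≠ 0)
  have hcorr : ∀ h k : ℕ, Tendsto (fun n => average n fun t =>
      f n (t + h) * (starRingEnd ℂ) (f n (t + k))) L (nhds (if h = k then 1 else 0)) := by
    intro h k
    split_ifs with hk
    · subst hk
      refine tendsto_const_nhds.congr' ?_
      filter_upwards [hL (eventually_ge_atTop 1)] with n hn
      rw [← average_const hn (1 : ℂ)]
      refine average_congr fun t => ?_
      rw [Complex.mul_conj', norm_cis]; norm_num
    · have hr : (2 * ((h : ℤ) - k)) ≠ 0 := by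
        have : (h : ℤ) - k ≠ 0 := sub_ne_zero.2 (by exact_mod_cast hk)
        omega
      have := tendsto_average_cis_linear hL (u := fun n => ((2 * ((h : ℤ) - k) : ℤ) : ℝ) * γ n)
        (c := fun n => γ n * (h ^ 2 - k ^ 2) + u n * (h - k)) (hγ.const_mul _)
        (cis_ne_one_of_irrational hg hr)
      refine this.congr fun n => average_congr fun t => ?_
      rw [← cis_sub]
      congr 1
      push_cast
      ring
  have hlim : Tendsto (fun n => average n (fun t =>
      ‖((H + 1 : ℕ) : ℂ)⁻¹ * ∑ h ∈ Finset.range (H + 1), f n (t + h)‖ ^ 2)) L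
      (nhds (1 / (H + 1 : ℝ))) := by
    have h1 : Tendsto (fun n => ((average n (fun t =>
        ‖((H + 1 : ℕ) : ℂ)⁻¹ * ∑ h ∈ Finset.range (H + 1), f n (t + h)‖ ^ 2) : ℝ) : ℂ)) L
        (nhds (∑ h ∈ Finset.range (H + 1), ∑ k ∈ Finset.range (H + 1),
          (((H + 1 : ℕ) : ℂ)⁻¹ * ((H + 1 : ℕ) : ℂ)⁻¹) * if h = k then 1 else 0)) := by
      simp_rw [average_normSq_shift_eq]
      exact tendsto_finsetSum _ fun h _ => tendsto_finsetSum _ fun k _ => (hcorr h k).const_mul _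
    have h2 := (Complex.continuous_re.tendsto _).comp h1
    have h3 : (∑ h ∈ Finset.range (H + 1), ∑ k ∈ Finset.range (H + 1),
          (((H + 1 : ℕ) : ℂ)⁻¹ * ((H + 1 : ℕ) : ℂ)⁻¹) * if h = k then 1 else 0) =
        ((1 / (H + 1 : ℝ) : ℝ) : ℂ) := by
      rw [Finset.sum_congr rfl fun h hh => by
        rw [← Finset.mul_sum, Finset.sum_ite_eq, if_pos hh, mul_one]]
      rw [Finset.sum_const, Finset.card_range, nsmul_eq_mul]
      push_cast at hHc ⊢
      field_simp
    rw [h3, Complex.ofReal_re] at h2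
    exact h2
  have hsmall : Tendsto (fun n : ℕ => 2 * ((H + 1 : ℕ) : ℝ) / n) L (nhds 0) :=
    (tendsto_const_div_atTop_nhds_zero_nat _).mono_left hL
  filter_upwards [hlim.eventually (gt_mem_nhds hH),
    hsmall.eventually (gt_mem_nhds (half_pos hε)), hL (eventually_ge_atTop 1)] with n h1 h2 hn
  have h3 := norm_average_sub_average_shift_le (f := f n) (fun t => (norm_cis _).le) n
    (H := H + 1) (by omega)
  have h4 := lt_of_pow_lt_pow_left₀ 2 (half_pos hε).le ((norm_average_sq_le hn _).trans_lt h1)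
  rw [dist_zero_right]
  have h5 := norm_sub_norm_le (average n (f n)) (average n (fun t =>
    ((H + 1 : ℕ) : ℂ)⁻¹ * ∑ h ∈ Finset.range (H + 1), f n (t + h)))
  rw [norm_sub_rev] at h5
  linarith

/-- If the averages of nonnegative functions tend to zero, there is a single point at whose images
under finitely many injective maps of at most fourfold growth the functions all tend to zero. -/
theorem exists_common_point {ι : Type*} [Fintype ι] {L : Filter ℕ} (hL : L ≤ atTop)
    {F : ℕ → ℕ → ℝ} (hF : ∀ n t, 0 ≤ F n t)
    (hlim : Tendsto (fun n => average n (F n)) L (nhds 0)) (g : ι → ℕ → ℕ)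
    (hinj : ∀ i, Function.Injective (g i)) (hg : ∀ i t, 1 ≤ t → 1 ≤ g i t ∧ g i t ≤ 4 * t) :
    ∃ τ : ℕ → ℕ, ∀ i, Tendsto (fun n => F n (g i (τ n))) L (nhds 0) := by
  have hex : ∀ n, ∃ t, 4 ≤ n → ∑ i, F n (g i t) ≤ 8 * Fintype.card ι * average n (F n) := by
    intro n
    by_cases hn : 4 ≤ n
    swap
    · exact ⟨0, fun h => absurd h hn⟩
    set m := n / 4 with hm
    have hm1 : 1 ≤ m := by omega
    have hmpos : (0 : ℝ) < m := by exact_mod_cast hm1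
    have hnpos : (0 : ℝ) < n := by exact_mod_cast (by omega : 0 < n)
    have hm8 : (n : ℝ) ≤ 8 * m := by exact_mod_cast (by omega : n ≤ 8 * m)
    have hone : ∀ i, ∑ t ∈ Finset.Icc 1 m, F n (g i t) ≤ ∑ t ∈ Finset.Icc 1 n, F n t := by
      intro i
      rw [← Finset.sum_image (f := F n) (fun a _ b _ h => hinj i h)]
      refine Finset.sum_le_sum_of_subset_of_nonneg (fun x hx => ?_) fun t _ _ => hF n t
      obtain ⟨t, ht, rfl⟩ := Finset.mem_image.1 hx
      rw [Finset.mem_Icc] at ht ⊢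
      have := hg i t ht.1
      omega
    have hS0 : 0 ≤ ∑ t ∈ Finset.Icc 1 n, F n t := Finset.sum_nonneg fun t _ => hF n t
    have hsum : ∑ t ∈ Finset.Icc 1 m, ∑ i, F n (g i t) ≤
        ∑ _t ∈ Finset.Icc 1 m, 8 * Fintype.card ι * average n (F n) := by
      rw [Finset.sum_comm]
      calc _ ≤ ∑ _i : ι, ∑ t ∈ Finset.Icc 1 n, F n t := Finset.sum_le_sum fun i _ => hone i
        _ = Fintype.card ι * ∑ t ∈ Finset.Icc 1 n, F n t := by simp
        _ ≤ (8 * m / n) * (Fintype.card ι * ∑ t ∈ Finset.Icc 1 n, F n t) := by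
            refine le_mul_of_one_le_left (by positivity) ?_
            rwa [le_div_iff₀ hnpos, one_mul]
        _ = _ := by simp [average]; ring
    obtain ⟨t, _, ht⟩ := Finset.exists_le_of_sum_le ⟨1, Finset.mem_Icc.2 ⟨le_rfl, hm1⟩⟩ hsum
    exact ⟨t, fun _ => ht⟩
  choose τ hτ using hex
  refine ⟨τ, fun i => squeeze_zero' (Eventually.of_forall fun n => hF _ _) ?_
    (by simpa using hlim.const_mul (8 * Fintype.card ι : ℝ))⟩
  filter_upwards [hL (eventually_ge_atTop 4)] with n hn
  exact (Finset.single_le_sum (f := fun i => F n (g i (τ n))) (fun j _ => hF _ _)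
    (Finset.mem_univ i)).trans (hτ n hn)

theorem tendsto_of_norm_sub_sq {L : Filter ℕ} {f : ℕ → ℂ} {z : ℂ}
    (h : Tendsto (fun n => ‖z - f n‖ ^ 2) L (nhds 0)) : Tendsto f L (nhds z) := by
  rw [tendsto_iff_norm_sub_tendsto_zero]
  have := h.sqrt
  simp only [Real.sqrt_sq (norm_nonneg _), Real.sqrt_zero] at this
  simpa only [norm_sub_rev] using this

theorem tendsto_of_average_norm_sub_linear {L : Filter ℕ} (hL : L ≤ atTop) {z : ℂ} (hz : z ≠ 0)
    {w : ℕ → ℂ} {γ : ℕ → ℝ}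
    (h : Tendsto (fun n => average n fun t => ‖z - w n * cis (γ n * t)‖ ^ 2) L (nhds 0)) :
    Tendsto w L (nhds z) := by
  obtain ⟨τ, hτ⟩ := exists_common_point hL (fun n t => by positivity) h
    ![fun t => t, fun t => 2 * t]
    (by simp [Fin.forall_fin_succ, Function.Injective])
    (by intro i t ht; fin_cases i <;> simp <;> omega)
  set x : ℕ → ℂ := fun n => cis (γ n * τ n) with hx
  have h1 : Tendsto (fun n => w n * x n) L (nhds z) := tendsto_of_norm_sub_sq (hτ 0)
  have h2 : Tendsto (fun n => w n * x n ^ 2) L (nhds z) := by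
    refine tendsto_of_norm_sub_sq ((hτ 1).congr fun n => ?_)
    simp only [hx]
    rw [← cis_natCast_mul]
    congr 5
    simp
    ring
  have hx0 : ∀ n, x n ≠ 0 := fun n => cis_ne_zero _
  have hx1 : Tendsto x L (nhds 1) := by
    have := h2.div h1 hz
    rw [div_self hz] at this
    refine this.congr' ?_
    filter_upwards [h1.eventually_ne hz] with n hn
    have hw : w n ≠ 0 := left_ne_zero_of_mul hn
    have := hx0 n
    simp only [Pi.div_apply]
    field_simp
  have := h1.div hx1 one_ne_zero
  rw [div_one] at this
  refine this.congr fun n => ?_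
  have := hx0 n
  simp only [Pi.div_apply]
  field_simp

theorem tendsto_of_average_norm_sub_quadratic {L : Filter ℕ} (hL : L ≤ atTop) {z : ℂ} (hz : z ≠ 0)
    {w : ℕ → ℂ} {γ : ℕ → ℝ}
    (h : Tendsto (fun n => average n fun t => ‖z - w n * cis (γ n * (t : ℝ) ^ 2)‖ ^ 2) L
      (nhds 0)) :
    Tendsto w L (nhds z) ∧ Tendsto (fun n => cis (γ n)) L (nhds 1) := by
  obtain ⟨τ, hτ⟩ := exists_common_point hL (fun n t => by positivity) h
    ![fun t => t, fun t => 2 * t, fun t => 3 * t, fun t => t + 1, fun t => 2 * t + 1]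
    (by simp [Fin.forall_fin_succ, Function.Injective])
    (by intro i t ht; fin_cases i <;> simp <;> omega)
  set x : ℕ → ℂ := fun n => cis (γ n * (τ n : ℝ) ^ 2) with hx
  set u : ℕ → ℂ := fun n => cis (2 * γ n * τ n) with hu
  set c : ℕ → ℂ := fun n => cis (γ n) with hc
  have hx0 : ∀ n, x n ≠ 0 := fun n => cis_ne_zero _
  have hu0 : ∀ n, u n ≠ 0 := fun n => cis_ne_zero _
  have hc0 : ∀ n, c n ≠ 0 := fun n => cis_ne_zero _
  have h1 : Tendsto (fun n => w n * x n) L (nhds z) := tendsto_of_norm_sub_sq (hτ 0)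
  have h2 : Tendsto (fun n => w n * x n ^ 4) L (nhds z) := by
    refine tendsto_of_norm_sub_sq ((hτ 1).congr fun n => ?_)
    simp only [hx]
    rw [← cis_natCast_mul]
    congr 5
    simp
    ring
  have h3 : Tendsto (fun n => w n * x n ^ 9) L (nhds z) := by
    refine tendsto_of_norm_sub_sq ((hτ 2).congr fun n => ?_)
    simp only [hx]
    rw [← cis_natCast_mul]
    congr 5
    simp
    ring
  have h4 : Tendsto (fun n => w n * (x n * u n * c n)) L (nhds z) := by
    refine tendsto_of_norm_sub_sq ((hτ 3).congr fun n => ?_)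
    simp only [hx, hu, hc]
    rw [← cis_add, ← cis_add]
    congr 5
    simp
    ring
  have h5 : Tendsto (fun n => w n * (x n ^ 4 * u n ^ 2 * c n)) L (nhds z) := by
    refine tendsto_of_norm_sub_sq ((hτ 4).congr fun n => ?_)
    simp only [hx, hu, hc]
    rw [← cis_natCast_mul, ← cis_natCast_mul, ← cis_add, ← cis_add]
    congr 5
    simp
    ring
  have hw : ∀ᶠ n in L, w n ≠ 0 := by
    filter_upwards [h1.eventually_ne hz] with n hn using left_ne_zero_of_mul hn
  have quot : ∀ {f g q : ℕ → ℂ}, Tendsto (fun n => w n * f n) L (nhds z) →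
      Tendsto (fun n => w n * g n) L (nhds z) → (∀ n, g n = f n * q n) → (∀ n, f n ≠ 0) →
      Tendsto q L (nhds 1) := by
    intro f g q hf hg hq hf0
    have := hg.div hf hz
    rw [div_self hz] at this
    refine this.congr' ?_
    filter_upwards [hw] with n hn
    have := hf0 n
    simp only [Pi.div_apply, hq]
    field_simp
  have q1 : Tendsto (fun n => x n ^ 3) L (nhds 1) := quot h1 h2 (fun n => by ring) hx0
  have q2 : Tendsto (fun n => x n ^ 8) L (nhds 1) := quot h1 h3 (fun n => by ring) hx0
  have q3 : Tendsto (fun n => u n * c n) L (nhds 1) := quot h1 h4 (fun n => by ring) hx0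
  have q4 : Tendsto (fun n => u n ^ 2 * c n) L (nhds 1) :=
    quot h2 h5 (fun n => by ring) fun n => pow_ne_zero _ (hx0 n)
  have hx1 : Tendsto x L (nhds 1) := by
    have := (q1.pow 3).div q2 one_ne_zero
    simp only [one_pow, div_one] at this
    refine this.congr fun n => ?_
    have := hx0 n
    simp only [Pi.div_apply]
    field_simp
  refine ⟨?_, ?_⟩
  · have := h1.div hx1 one_ne_zero
    rw [div_one] at this
    refine this.congr fun n => ?_
    have := hx0 n
    simp only [Pi.div_apply]
    field_simp
  · have := (q3.pow 2).div q4 one_ne_zero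
    simp only [one_pow, div_one] at this
    refine this.congr fun n => ?_
    have := hu0 n
    have := hc0 n
    simp only [Pi.div_apply]
    field_simp

/-- The real oscillation `Re (z e^{iφ})` with amplitude and phase depending on the sample size. -/
noncomputable def osc (z : ℕ → ℂ) (φ : ℕ → ℕ → ℝ) (n t : ℕ) : ℝ := (z n * cis (φ n t)).re

/-- Neither the sum nor the difference of the two phases has a nonvanishing mean. -/
def Decorrelated (L : Filter ℕ) (φ ψ : ℕ → ℕ → ℝ) : Prop :=
  Tendsto (fun n => average n fun t => cis (φ n t + ψ n t)) L (nhds 0) ∧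
    Tendsto (fun n => average n fun t => cis (φ n t - ψ n t)) L (nhds 0)

theorem Decorrelated.symm {L : Filter ℕ} {φ ψ : ℕ → ℕ → ℝ} (h : Decorrelated L φ ψ) :
    Decorrelated L ψ φ := by
  refine ⟨by simpa only [add_comm] using h.1, ?_⟩
  have := (Complex.continuous_conj.tendsto _).comp h.2
  rw [map_zero] at this
  refine this.congr fun n => ?_
  rw [Function.comp_apply, conj_average]
  exact average_congr fun t => by rw [conj_cis, neg_sub]

theorem tendsto_average_re_mul_cis {L : Filter ℕ} {χ : ℕ → ℕ → ℝ} {z : ℕ → ℂ} {z' : ℂ}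
    (hz : Tendsto z L (nhds z')) (h : Tendsto (fun n => average n fun t => cis (χ n t)) L (nhds 0)) :
    Tendsto (fun n => average n fun t => (z n * cis (χ n t)).re) L (nhds 0) := by
  have := (Complex.continuous_re.tendsto _).comp (hz.mul h)
  simp only [mul_zero, Complex.zero_re] at this
  refine this.congr fun n => ?_
  rw [Function.comp_apply, ← average_const_mul, re_average]

theorem Decorrelated.tendsto_average_mul {L : Filter ℕ} {φ ψ : ℕ → ℕ → ℝ}
    (h : Decorrelated L φ ψ) {z w : ℕ → ℂ} {z' w' : ℂ} (hz : Tendsto z L (nhds z'))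
    (hw : Tendsto w L (nhds w')) :
    Tendsto (fun n => average n fun t => osc z φ n t * osc w ψ n t) L (nhds 0) := by
  have h1 := tendsto_average_re_mul_cis (hz.mul hw) h.1
  have h2 := tendsto_average_re_mul_cis (hz.mul ((Complex.continuous_conj.tendsto _).comp hw)) h.2
  have h3 := (h1.add h2).const_mul (1 / 2)
  simp only [add_zero, mul_zero] at h3
  refine h3.congr fun n => ?_
  rw [← average_add, ← average_const_mul]
  refine average_congr fun t => ?_
  rw [cis_add, cis_sub, osc, osc]
  simp [Complex.mul_re, Complex.mul_im]
  ring

theorem tendsto_average_osc_sq {L : Filter ℕ} (hL : L ≤ atTop) {φ : ℕ → ℕ → ℝ}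
    (h : Tendsto (fun n => average n fun t => cis (φ n t + φ n t)) L (nhds 0)) {z : ℕ → ℂ} {z' : ℂ}
    (hz : Tendsto z L (nhds z')) :
    Tendsto (fun n => average n fun t => osc z φ n t * osc z φ n t) L (nhds (‖z'‖ ^ 2 / 2)) := by
  have h1 := tendsto_average_re_mul_cis (hz.mul hz) h
  have h3 := (h1.add (hz.norm.pow 2)).const_mul (1 / 2)
  rw [zero_add, one_div_mul_eq_div] at h3
  refine h3.congr' ?_
  filter_upwards [hL (eventually_ge_atTop 1)] with n hn
  rw [← average_const hn (‖z n‖ ^ 2), ← average_add, ← average_const_mul]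
  refine average_congr fun t => ?_
  have e : ‖z n‖ ^ 2 = Complex.normSq (z n * cis (φ n t)) := by
    rw [Complex.normSq_eq_norm_sq, norm_mul, norm_cis, mul_one]
  rw [e, Complex.normSq_apply, cis_add, osc]
  simp [Complex.mul_re, Complex.mul_im]
  ring

theorem tendsto_average_norm_sub_sq {L : Filter ℕ} {φ ψ : ℕ → ℕ → ℝ}
    (hφ : Tendsto (fun n => average n fun t => cis (φ n t + φ n t)) L (nhds 0))
    (hψ : Tendsto (fun n => average n fun t => cis (ψ n t + ψ n t)) L (nhds 0))
    (hφψ : Tendsto (fun n => average n fun t => cis (φ n t + ψ n t)) L (nhds 0))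
    {z w : ℕ → ℂ} {z' w' : ℂ} (hz : Tendsto z L (nhds z')) (hw : Tendsto w L (nhds w'))
    (h : Tendsto (fun n => average n fun t => (osc z φ n t - osc w ψ n t) ^ 2) L (nhds 0)) :
    Tendsto (fun n => average n fun t => ‖z n - w n * cis (ψ n t - φ n t)‖ ^ 2) L (nhds 0) := by
  have h1 := tendsto_average_re_mul_cis (hz.mul hz) hφ
  have h2 := tendsto_average_re_mul_cis (hw.mul hw) hψ
  have h3 := tendsto_average_re_mul_cis (hz.mul hw) hφψ
  have h4 := (((h.const_mul 2).sub h1).sub h2).add (h3.const_mul 2)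
  simp only [mul_zero, sub_zero, add_zero] at h4
  refine h4.congr fun n => ?_
  simp only [← average_const_mul]
  rw [← average_sub, ← average_sub, ← average_add]
  refine average_congr fun t => ?_
  have e : ‖z n - w n * cis (ψ n t - φ n t)‖ ^ 2 =
      Complex.normSq (z n * cis (φ n t) - w n * cis (ψ n t)) := by
    rw [Complex.normSq_eq_norm_sq, ← mul_one ‖z n - _‖, ← norm_cis (φ n t), ← norm_mul, sub_mul,
      mul_assoc (w n), ← cis_add, sub_add_cancel]
  rw [e, Complex.normSq_apply]
  simp only [osc, cis_add]
  simp [Complex.mul_re, Complex.mul_im]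
  ring

theorem tendsto_average_mul_of_bounded {L : Filter ℕ} {f g : ℕ → ℕ → ℝ} {C : ℝ}
    (hL : L ≤ atTop) (hg : ∀ᶠ n in L, ∀ t, |g n t| ≤ C)
    (hf : Tendsto (fun n => average n fun t => f n t ^ 2) L (nhds 0)) :
    Tendsto (fun n => average n fun t => g n t * f n t) L (nhds 0) := by
  have hlim : Tendsto (fun n => Real.sqrt (C ^ 2 * average n fun t => f n t ^ 2)) L (nhds 0) := by
    simpa using (hf.const_mul (C ^ 2)).sqrt
  refine squeeze_zero_norm' ?_ hlim
  filter_upwards [hg, hL (eventually_ge_atTop 1)] with n hn hn1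
  refine Real.abs_le_sqrt ((sq_average_mul_le n (g n) (f n)).trans ?_)
  refine mul_le_mul_of_nonneg_right ?_ (average_nonneg fun t => sq_nonneg _)
  rw [← average_const hn1 (C ^ 2)]
  exact average_mono fun t => sq_le_sq' (by linarith [neg_abs_le (g n t), hn t])
    ((le_abs_self _).trans (hn t))

theorem eventually_abs_osc_le {L : Filter ℕ} {z : ℕ → ℂ} {z' : ℂ} (hz : Tendsto z L (nhds z'))
    (φ : ℕ → ℕ → ℝ) : ∀ᶠ n in L, ∀ t, |osc z φ n t| ≤ ‖z'‖ + 1 := by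
  filter_upwards [hz.norm.eventually (gt_mem_nhds (lt_add_one ‖z'‖))] with n hn t
  refine (Complex.abs_re_le_norm _).trans ?_
  rw [norm_mul, norm_cis, mul_one]
  exact hn.le

section Matching

variable {K : Type*} [Fintype K] [DecidableEq K] {L : Filter ℕ} {ζ : K → ℂ} {z : K → ℕ → ℂ}
  {z' : K → ℂ} {φ ψ : K → ℕ → ℕ → ℝ}

theorem exists_not_decorrelated [L.NeBot] (hL : L ≤ atTop)
    (hz : ∀ l, Tendsto (z l) L (nhds (z' l)))
    (hlim : Tendsto (fun n => average n fun t =>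
      (∑ k, osc (fun _ => ζ k) (φ k) n t - ∑ l, osc (z l) (ψ l) n t) ^ 2) L (nhds 0))
    {k : K} (hk : ζ k ≠ 0)
    (hself : Tendsto (fun n => average n fun t => cis (φ k n t + φ k n t)) L (nhds 0))
    (hother : ∀ k', k' ≠ k → Decorrelated L (φ k) (φ k')) :
    ∃ l, ¬ Decorrelated L (φ k) (ψ l) := by
  by_contra! hcon
  have hc : Tendsto (fun _ : ℕ => ζ k) L (nhds (ζ k)) := tendsto_const_nhds
  have h0 := tendsto_average_mul_of_bounded hL (eventually_abs_osc_le hc (φ k)) hlim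
  have h1 : Tendsto (fun n => ∑ k', average n fun t =>
      osc (fun _ => ζ k) (φ k) n t * osc (fun _ => ζ k') (φ k') n t) L
      (nhds (∑ k', if k' = k then ‖ζ k‖ ^ 2 / 2 else 0)) := by
    refine tendsto_finsetSum _ fun k' _ => ?_
    split_ifs with h
    · subst h
      exact tendsto_average_osc_sq hL hself hc
    · exact (hother k' h).tendsto_average_mul hc tendsto_const_nhds
  have h2 : Tendsto (fun n => ∑ l, average n fun t =>
      osc (fun _ => ζ k) (φ k) n t * osc (z l) (ψ l) n t) L (nhds (∑ _l : K, 0)) :=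
    tendsto_finsetSum _ fun l _ => (hcon l).tendsto_average_mul hc (hz l)
  have h3 := h1.sub h2
  rw [Finset.sum_ite_eq' Finset.univ k, if_pos (Finset.mem_univ _), Finset.sum_const_zero,
    sub_zero] at h3
  have h4 := tendsto_nhds_unique h0 (h3.congr fun n => by
    rw [← average_sum, ← average_sum, ← average_sub]
    exact average_congr fun t => by rw [← Finset.mul_sum, ← Finset.mul_sum, ← mul_sub])
  have : 0 < ‖ζ k‖ := norm_pos_iff.2 hk
  have : 0 < ‖ζ k‖ ^ 2 / 2 := by positivity
  exact absurd h4 this.ne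

theorem tendsto_average_sub_sq_of_decorrelated (hL : L ≤ atTop)
    (hz : ∀ l, Tendsto (z l) L (nhds (z' l)))
    (hlim : Tendsto (fun n => average n fun t =>
      (∑ k, osc (fun _ => ζ k) (φ k) n t - ∑ l, osc (z l) (ψ l) n t) ^ 2) L (nhds 0))
    {k l : K} (h1 : ∀ k', k' ≠ k → Decorrelated L (φ k) (φ k'))
    (h2 : ∀ k', k' ≠ k → Decorrelated L (ψ l) (φ k'))
    (h3 : ∀ l', l' ≠ l → Decorrelated L (φ k) (ψ l'))
    (h4 : ∀ l', l' ≠ l → Decorrelated L (ψ l) (ψ l')) :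
    Tendsto (fun n => average n fun t =>
      (osc (fun _ => ζ k) (φ k) n t - osc (z l) (ψ l) n t) ^ 2) L (nhds 0) := by
  have hc : ∀ k, Tendsto (fun _ : ℕ => ζ k) L (nhds (ζ k)) := fun k => tendsto_const_nhds
  set D : ℕ → ℕ → ℝ := fun n t => osc (fun _ => ζ k) (φ k) n t - osc (z l) (ψ l) n t with hD
  have hDb : ∀ᶠ n in L, ∀ t, |D n t| ≤ (‖ζ k‖ + 1) + (‖z' l‖ + 1) := by
    filter_upwards [eventually_abs_osc_le (hc k) (φ k), eventually_abs_osc_le (hz l) (ψ l)]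
      with n ha hb t
    exact (abs_sub _ _).trans (add_le_add (ha t) (hb t))
  have e0 := tendsto_average_mul_of_bounded hL hDb hlim
  have e1 : Tendsto (fun n => ∑ k' ∈ Finset.univ.erase k, average n fun t =>
      D n t * osc (fun _ => ζ k') (φ k') n t) L (nhds (∑ k' ∈ Finset.univ.erase k, (0 - 0))) := by
    refine tendsto_finsetSum _ fun k' hk' => ?_
    have hne := Finset.ne_of_mem_erase hk'
    refine (((h1 k' hne).tendsto_average_mul (hc k) (hc k')).sub
      ((h2 k' hne).tendsto_average_mul (hz l) (hc k'))).congr fun n => ?_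
    rw [← average_sub]
    exact average_congr fun t => by rw [hD, sub_mul]
  have e2 : Tendsto (fun n => ∑ l' ∈ Finset.univ.erase l, average n fun t =>
      D n t * osc (z l') (ψ l') n t) L (nhds (∑ l' ∈ Finset.univ.erase l, (0 - 0))) := by
    refine tendsto_finsetSum _ fun l' hl' => ?_
    have hne := Finset.ne_of_mem_erase hl'
    refine (((h3 l' hne).tendsto_average_mul (hc k) (hz l')).sub
      ((h4 l' hne).tendsto_average_mul (hz l) (hz l'))).congr fun n => ?_
    rw [← average_sub]
    exact average_congr fun t => by rw [hD, sub_mul]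
  have e3 := (e0.sub e1).add e2
  simp only [sub_zero, Finset.sum_const_zero, add_zero] at e3
  refine e3.congr fun n => ?_
  rw [← average_sum, ← average_sum, ← average_sub, ← average_add]
  refine average_congr fun t => ?_
  rw [← Finset.mul_sum, ← Finset.mul_sum,
    ← Finset.add_sum_erase _ (fun k => osc (fun _ => ζ k) (φ k) n t) (Finset.mem_univ k),
    ← Finset.add_sum_erase _ (fun l => osc (z l) (ψ l) n t) (Finset.mem_univ l)]
  simp only [hD]
  ring

end Matching

/-- The phase `a t` of a sinusoid whose frequency depends on the sample size. -/
def linearPhase (a : ℕ → ℝ) (n t : ℕ) : ℝ := a n * t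

/-- The phase `b t²` of a chirp term whose frequency rate depends on the sample size. -/
def quadraticPhase (b : ℕ → ℝ) (n t : ℕ) : ℝ := b n * (t : ℝ) ^ 2

section Phases

variable {L : Filter ℕ} {a b : ℕ → ℝ} {a' b' : ℝ}

theorem decorrelated_quadratic_quadratic (hL : L ≤ atTop) (ha : Tendsto a L (nhds a'))
    (hb : Tendsto b L (nhds b')) (hadd : Irrational ((a' + b') / Real.pi))
    (hsub : Irrational ((a' - b') / Real.pi)) :
    Decorrelated L (quadraticPhase a) (quadraticPhase b) := by
  have h1 := tendsto_average_cis_quadratic hL (u := fun _ => 0) (ha.add hb) hadd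
  have h2 := tendsto_average_cis_quadratic hL (u := fun _ => 0) (ha.sub hb) hsub
  refine ⟨h1.congr fun n => average_congr fun t => ?_, h2.congr fun n => average_congr fun t => ?_⟩
  all_goals
    unfold quadraticPhase
    ring_nf

theorem tendsto_average_cis_quadratic_double (hL : L ≤ atTop) (ha : Tendsto a L (nhds a'))
    (h : Irrational ((a' + a') / Real.pi)) :
    Tendsto (fun n => average n fun t => cis (quadraticPhase a n t + quadraticPhase a n t)) L
      (nhds 0) := by
  refine (tendsto_average_cis_quadratic hL (u := fun _ => 0) (ha.add ha) h).congr fun n =>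
    average_congr fun t => ?_
  unfold quadraticPhase
  ring_nf

theorem decorrelated_quadratic_linear (hL : L ≤ atTop) (ha : Tendsto a L (nhds a'))
    (h : Irrational (a' / Real.pi)) (b : ℕ → ℝ) :
    Decorrelated L (quadraticPhase a) (linearPhase b) := by
  have h1 := tendsto_average_cis_quadratic hL (u := b) ha h
  have h2 := tendsto_average_cis_quadratic hL (u := fun n => -b n) ha h
  refine ⟨h1.congr fun n => average_congr fun t => ?_, h2.congr fun n => average_congr fun t => ?_⟩
  all_goals
    unfold quadraticPhase linearPhase
    ring_nf

theorem decorrelated_linear_linear (hL : L ≤ atTop) (ha : Tendsto a L (nhds a'))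
    (hb : Tendsto b L (nhds b')) (hadd : cis (a' + b') ≠ 1) (hsub : cis (a' - b') ≠ 1) :
    Decorrelated L (linearPhase a) (linearPhase b) := by
  have h1 := tendsto_average_cis_linear hL (c := fun _ => 0) (ha.add hb) hadd
  have h2 := tendsto_average_cis_linear hL (c := fun _ => 0) (ha.sub hb) hsub
  refine ⟨h1.congr fun n => average_congr fun t => ?_, h2.congr fun n => average_congr fun t => ?_⟩
  all_goals
    unfold linearPhase
    ring_nf

theorem tendsto_average_cis_linear_double (hL : L ≤ atTop) (ha : Tendsto a L (nhds a'))
    (h : cis (a' + a') ≠ 1) :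
    Tendsto (fun n => average n fun t => cis (linearPhase a n t + linearPhase a n t)) L
      (nhds 0) := by
  refine (tendsto_average_cis_linear hL (c := fun _ => 0) (ha.add ha) h).congr fun n =>
    average_congr fun t => ?_
  unfold linearPhase
  ring_nf

end Phases

/-- `x + y` or `x - y` is a rational multiple of `π`. -/
def Resonant (x y : ℝ) : Prop :=
  ¬ (Irrational ((x + y) / Real.pi) ∧ Irrational ((x - y) / Real.pi))

theorem resonant_iff {x y : ℝ} :
    Resonant x y ↔ (∃ r : ℚ, x + y = r * Real.pi) ∨ ∃ r : ℚ, x - y = r * Real.pi := by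
  have h : ∀ w : ℝ, ¬ Irrational (w / Real.pi) ↔ ∃ r : ℚ, w = r * Real.pi := by
    intro w
    rw [irrational_iff_ne_rational]
    push Not
    constructor
    · rintro ⟨a, b, hb, h⟩
      refine ⟨a / b, ?_⟩
      rw [div_eq_iff Real.pi_ne_zero] at h
      push_cast
      exact h
    · rintro ⟨r, rfl⟩
      refine ⟨r.num, r.den, by exact_mod_cast r.den_ne_zero, ?_⟩
      rw [mul_div_assoc, div_self Real.pi_ne_zero, mul_one]
      exact_mod_cast (Rat.num_div_den r).symm
  rw [Resonant, not_and_or, h, h]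

theorem Resonant.symm {x y : ℝ} (h : Resonant x y) : Resonant y x := by
  rw [resonant_iff] at h ⊢
  rcases h with ⟨r, hr⟩ | ⟨r, hr⟩
  · exact Or.inl ⟨r, by linarith⟩
  · exact Or.inr ⟨-r, by push_cast; linarith⟩

theorem Resonant.trans {x y w : ℝ} (h : Resonant x y) (h' : Resonant y w) : Resonant x w := by
  rw [resonant_iff] at h h' ⊢
  rcases h with ⟨r, hr⟩ | ⟨r, hr⟩ <;> rcases h' with ⟨s, hs⟩ | ⟨s, hs⟩
  · exact Or.inr ⟨r - s, by push_cast; linarith⟩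
  · exact Or.inl ⟨r - s, by push_cast; linarith⟩
  · exact Or.inl ⟨r + s, by push_cast; linarith⟩
  · exact Or.inr ⟨r + s, by push_cast; linarith⟩

theorem irrational_double_of_irrational {x : ℝ} (h : Irrational (x / Real.pi)) :
    Irrational ((x + x) / Real.pi) := by
  have := h.ratCast_mul (q := 2) (by norm_num)
  convert this using 1
  push_cast
  ring

theorem irrational_of_not_resonant_zero {x : ℝ} (h : ¬ Resonant x 0) : Irrational (x / Real.pi) := by
  have := (not_not.1 h).1
  rwa [add_zero] at this

theorem not_resonant_zero {x : ℝ} (h : Irrational (x / Real.pi)) : ¬ Resonant x 0 := by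
  rw [Resonant, not_not, add_zero, sub_zero]
  exact ⟨h, h⟩

theorem cis_ne_one_of_mem_Ioo {x : ℝ} (h : x ∈ Set.Ioo 0 (2 * Real.pi)) : cis x ≠ 1 := by
  intro h1
  obtain ⟨k, hk⟩ := (cis_eq_one_iff x).1 h1
  have hpi := Real.two_pi_pos
  rw [hk] at h
  have ha : (0 : ℝ) < k := pos_of_mul_pos_left h.1 hpi.le
  have hb : (k : ℝ) < 1 := by
    by_contra! hc
    have := h.2
    nlinarith
  have ha' : 0 < k := by exact_mod_cast ha
  have hb' : k < 1 := by exact_mod_cast hb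
  omega

theorem cis_neg_eq_one {x : ℝ} (h : cis x = 1) : cis (-x) = 1 := by
  rw [← conj_cis, h, map_one]

theorem eq_of_cis_sub_eq_one {x y : ℝ} (hx : x ∈ Set.Ioo 0 Real.pi) (hy : y ∈ Set.Icc 0 Real.pi)
    (h : cis (x - y) = 1) : x = y := by
  rcases lt_trichotomy x y with hlt | heq | hgt
  · refine absurd (cis_neg_eq_one h) (cis_ne_one_of_mem_Ioo ⟨?_, ?_⟩) <;>
      linarith [hx.1, hx.2, hy.1, hy.2]
  · exact heq
  · refine absurd h (cis_ne_one_of_mem_Ioo ⟨?_, ?_⟩) <;> linarith [hx.1, hx.2, hy.1, hy.2]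

theorem cis_add_ne_one {x y : ℝ} (hx : x ∈ Set.Ioo 0 Real.pi) (hy : y ∈ Set.Icc 0 Real.pi) :
    cis (x + y) ≠ 1 :=
  cis_ne_one_of_mem_Ioo ⟨by linarith [hx.1, hy.1], by linarith [hx.2, hy.2]⟩

theorem osc_eq_osc_conj_neg (w : ℕ → ℂ) (b : ℕ → ℝ) :
    osc w (quadraticPhase b) =
      osc (fun n => (starRingEnd ℂ) (w n)) (quadraticPhase fun n => -b n) := by
  funext n t
  have e : quadraticPhase (fun n => -b n) n t = -quadraticPhase b n t := by
    simp [quadraticPhase]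
  rw [osc, osc, e, ← conj_cis, ← map_mul, Complex.conj_re]

theorem limit_eq_of_average_sub_sq_quadratic {L : Filter ℕ} [L.NeBot] (hL : L ≤ atTop)
    {ζ : ℂ} (hζ : ζ ≠ 0) {w : ℕ → ℂ} {w' : ℂ} (hw : Tendsto w L (nhds w')) {b₀ : ℝ} {b : ℕ → ℝ}
    {b' : ℝ} (hb : Tendsto b L (nhds b')) (hirr : Irrational (b₀ / Real.pi))
    (hadd : Irrational ((b₀ + b') / Real.pi)) (hirr' : Irrational (b' / Real.pi))
    (h : Tendsto (fun n => average n fun t =>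
      (osc (fun _ => ζ) (quadraticPhase fun _ => b₀) n t - osc w (quadraticPhase b) n t) ^ 2) L
      (nhds 0)) :
    w' = ζ ∧ cis (b' - b₀) = 1 := by
  have hc : Tendsto (fun _ : ℕ => b₀) L (nhds b₀) := tendsto_const_nhds
  have h1 : Tendsto (fun n => average n fun t =>
      cis (quadraticPhase (fun _ => b₀) n t + quadraticPhase b n t)) L (nhds 0) := by
    refine (tendsto_average_cis_quadratic hL (u := fun _ => 0) (hc.add hb) hadd).congr fun n =>
      average_congr fun t => ?_
    unfold quadraticPhase
    ring_nf
  have h2 := tendsto_average_norm_sub_sq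
    (tendsto_average_cis_quadratic_double hL hc (irrational_double_of_irrational hirr))
    (tendsto_average_cis_quadratic_double hL hb (irrational_double_of_irrational hirr'))
    h1 tendsto_const_nhds hw h
  have h3 := tendsto_of_average_norm_sub_quadratic hL hζ (w := w) (γ := fun n => b n - b₀)
    (h2.congr fun n => average_congr fun t => by
      unfold quadraticPhase
      rw [sub_mul])
  exact ⟨tendsto_nhds_unique hw h3.1,
    tendsto_nhds_unique ((continuous_cis.tendsto _).comp (hb.sub hc)) h3.2⟩

theorem chirp_limit_eq {L : Filter ℕ} [L.NeBot] (hL : L ≤ atTop)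
    {ζ : ℂ} (hζ : ζ ≠ 0) {w : ℕ → ℂ} {w' : ℂ} (hw : Tendsto w L (nhds w')) {b₀ : ℝ} {b : ℕ → ℝ}
    {b' : ℝ} (hb : Tendsto b L (nhds b')) (hb₀ : b₀ ∈ Set.Ioo 0 Real.pi)
    (hb' : b' ∈ Set.Icc 0 Real.pi) (hirr : Irrational (b₀ / Real.pi)) (hres : Resonant b₀ b')
    (h : Tendsto (fun n => average n fun t =>
      (osc (fun _ => ζ) (quadraticPhase fun _ => b₀) n t - osc w (quadraticPhase b) n t) ^ 2) L
      (nhds 0)) :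
    w' = ζ ∧ b' = b₀ := by
  have hirr' : Irrational (b' / Real.pi) := irrational_of_not_resonant_zero fun h0 =>
    not_resonant_zero hirr (hres.trans h0)
  by_cases hadd : Irrational ((b₀ + b') / Real.pi)
  · obtain ⟨h1, h2⟩ := limit_eq_of_average_sub_sq_quadratic hL hζ hw hb hirr hadd hirr' h
    refine ⟨h1, (eq_of_cis_sub_eq_one hb₀ hb' ?_).symm⟩
    have := cis_neg_eq_one h2
    rwa [neg_sub] at this
  · exfalso
    have hsub : Irrational ((b₀ + -b') / Real.pi) := by
      by_contra hs
      have e : (b₀ + b₀) / Real.pi = (b₀ + b') / Real.pi + (b₀ + -b') / Real.pi := by ring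
      have h2 := irrational_double_of_irrational hirr
      rw [e] at h2
      rcases h2.add_cases with h3 | h3
      · exact hadd h3
      · exact hs h3
    have hneg : Irrational (-b' / Real.pi) := by rw [neg_div]; exact hirr'.neg
    rw [osc_eq_osc_conj_neg w] at h
    have h2 := (limit_eq_of_average_sub_sq_quadratic hL hζ
      ((Complex.continuous_conj.tendsto _).comp hw) hb.neg hirr hsub hneg h).2
    have h3 := cis_neg_eq_one h2
    rw [show -(-b' - b₀) = b₀ + b' by ring] at h3
    exact cis_add_ne_one hb₀ hb' h3

theorem sinusoid_limit_eq {L : Filter ℕ} [L.NeBot] (hL : L ≤ atTop)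
    {ζ : ℂ} (hζ : ζ ≠ 0) {w : ℕ → ℂ} {w' : ℂ} (hw : Tendsto w L (nhds w')) {a₀ : ℝ} {a : ℕ → ℝ}
    (ha : Tendsto a L (nhds a₀)) (ha₀ : a₀ ∈ Set.Ioo 0 Real.pi)
    (h : Tendsto (fun n => average n fun t =>
      (osc (fun _ => ζ) (linearPhase fun _ => a₀) n t - osc w (linearPhase a) n t) ^ 2) L
      (nhds 0)) :
    w' = ζ := by
  have hc : Tendsto (fun _ : ℕ => a₀) L (nhds a₀) := tendsto_const_nhds
  have hne : cis (a₀ + a₀) ≠ 1 := cis_add_ne_one ha₀ (Set.Ioo_subset_Icc_self ha₀)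
  have h1 : Tendsto (fun n => average n fun t =>
      cis (linearPhase (fun _ => a₀) n t + linearPhase a n t)) L (nhds 0) := by
    refine (tendsto_average_cis_linear hL (c := fun _ => 0) (hc.add ha) hne).congr fun n =>
      average_congr fun t => ?_
    unfold linearPhase
    ring_nf
  have h2 := tendsto_average_norm_sub_sq (tendsto_average_cis_linear_double hL hc hne)
    (tendsto_average_cis_linear_double hL ha hne) h1 tendsto_const_nhds hw h
  exact tendsto_nhds_unique hw
    (tendsto_of_average_norm_sub_linear hL hζ (w := w) (γ := fun n => a n - a₀)
      (h2.congr fun n => average_congr fun t => by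
        unfold linearPhase
        rw [sub_mul]))

theorem eq_id_of_antitone_comp {m : ℕ} {f : Fin m → Fin m} (hf : Function.Injective f)
    {g g₀ : Fin m → ℝ} (hg : Antitone g) (hg₀ : StrictAnti g₀) (h : ∀ k, g (f k) = g₀ k) :
    f = id := by
  have hmono : StrictMono f := by
    intro i j hij
    by_contra! hle
    have := hg hle
    rw [h, h] at this
    exact absurd (hg₀ hij) this.not_gt
  refine (StrictMono.range_inj hmono strictMono_id).1 ?_
  rw [(Finite.injective_iff_surjective.1 hf).range_eq, Set.range_id]

/-- The complex amplitude `A - iB` of the component `(A, B, ω)`. -/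
def Component.amp (c : Component) : ℂ := ⟨c.1, -c.2.1⟩

theorem Component.wave_eq_re (c : Component) (u : ℝ) :
    c.wave u = (c.amp * cis (c.2.2 * u)).re := by
  rw [Complex.mul_re, re_cis, im_cis]
  simp [Component.wave, Component.amp]

theorem Component.amp_ne_zero {c : Component} (h : 0 < c.power) : c.amp ≠ 0 := by
  intro h0
  have h1 : c.1 = 0 := congrArg Complex.re h0
  have h2 : -c.2.1 = 0 := congrArg Complex.im h0
  rw [neg_eq_zero] at h2
  simp [Component.power, h1, h2] at h

theorem Component.ext_amp {c d : Component} (h : c.amp = d.amp) (h' : c.2.2 = d.2.2) : c = d := by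
  have h1 : c.1 = d.1 := congrArg Complex.re h
  have h2 : -c.2.1 = -d.2.1 := congrArg Complex.im h
  exact Prod.ext h1 (Prod.ext (neg_injective h2) h')

theorem Component.continuous_amp : Continuous Component.amp := by
  have : Component.amp = fun c => ((c.1 : ℝ) : ℂ) + ((-c.2.1 : ℝ) : ℂ) * Complex.I := by
    funext c
    apply Complex.ext <;> simp [Component.amp]
  rw [this]
  fun_prop

theorem Component.continuous_power : Continuous Component.power := by
  unfold Component.power
  fun_prop

theorem isCompact_paramSpace (M : ℝ) (p q : ℕ) : IsCompact (paramSpace M p q) := by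
  have h : IsCompact (componentSpace M) := isCompact_Icc.prod (isCompact_Icc.prod isCompact_Icc)
  exact (isCompact_univ_pi fun _ => h).prod (isCompact_univ_pi fun _ => h)

theorem rates_mem_Ioo_of_mem_interior {M : ℝ} {p q : ℕ} {ϑ : Param p q}
    (h : ϑ ∈ interior (paramSpace M p q)) :
    (∀ j, (ϑ.1 j).2.2 ∈ Set.Ioo 0 Real.pi) ∧ ∀ k, (ϑ.2 k).2.2 ∈ Set.Ioo 0 Real.pi := by
  rw [paramSpace, interior_prod_eq, interior_pi_set Set.finite_univ,
    interior_pi_set Set.finite_univ] at h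
  have key : ∀ c : Component, c ∈ interior (componentSpace M) → c.2.2 ∈ Set.Ioo 0 Real.pi := by
    intro c hc
    rw [componentSpace, interior_prod_eq, interior_prod_eq, interior_Icc, interior_Icc] at hc
    exact hc.2.2
  exact ⟨fun j => key _ (h.1 j (Set.mem_univ j)), fun k => key _ (h.2 k (Set.mem_univ k))⟩

theorem signal_eq_sum_osc {p q : ℕ} (ϑ : ℕ → Param p q) (n t : ℕ) :
    signal (ϑ n) t = ∑ k : Fin p ⊕ Fin q,
      osc (Sum.elim (fun j n => ((ϑ n).1 j).amp) (fun l n => ((ϑ n).2 l).amp) k)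
        (Sum.elim (fun j => linearPhase fun n => ((ϑ n).1 j).2.2)
          (fun l => quadraticPhase fun n => ((ϑ n).2 l).2.2) k) n t := by
  rw [Fintype.sum_sum_type, signal]
  simp only [Component.wave_eq_re]
  rfl

theorem NonResonant.not_resonant {q : ℕ} {c : Fin q → Component} (h : NonResonant c) {k l : Fin q}
    (hkl : k ≠ l) : ¬ Resonant (c k).2.2 (c l).2.2 :=
  fun h' => h' (h.2 k l hkl)

theorem limit_eq_of_average_signal_sub_sq {p q : ℕ} {L : Filter ℕ} [L.NeBot] (hL : L ≤ atTop)
    {ϑ₀ ϑ' : Param p q} {ϑ : ℕ → Param p q}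
    (hα₀ : ∀ j, (ϑ₀.1 j).2.2 ∈ Set.Ioo 0 Real.pi) (hβ₀ : ∀ k, (ϑ₀.2 k).2.2 ∈ Set.Ioo 0 Real.pi)
    (h_freq : Function.Injective fun j => (ϑ₀.1 j).2.2) (h_nonres : NonResonant ϑ₀.2)
    (h_sin : StrictlyOrdered ϑ₀.1) (h_chirp : StrictlyOrdered ϑ₀.2)
    (hlim : Tendsto ϑ L (nhds ϑ'))
    (hα : ∀ j, (ϑ'.1 j).2.2 ∈ Set.Icc 0 Real.pi) (hβ : ∀ k, (ϑ'.2 k).2.2 ∈ Set.Icc 0 Real.pi)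
    (hord₁ : Antitone fun j => (ϑ'.1 j).power) (hord₂ : Antitone fun k => (ϑ'.2 k).power)
    (h : Tendsto (fun n => average n fun t => (signal ϑ₀ t - signal (ϑ n) t) ^ 2) L (nhds 0)) :
    ϑ' = ϑ₀ := by
  have hc₁ : ∀ j, Tendsto (fun n => (ϑ n).1 j) L (nhds (ϑ'.1 j)) := fun j =>
    ((continuous_apply j).comp continuous_fst).continuousAt.tendsto.comp hlim
  have hc₂ : ∀ k, Tendsto (fun n => (ϑ n).2 k) L (nhds (ϑ'.2 k)) := fun k =>
    ((continuous_apply k).comp continuous_snd).continuousAt.tendsto.comp hlim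
  have hr : Continuous fun c : Component => c.2.2 := continuous_snd.comp continuous_snd
  have hr₁ : ∀ j, Tendsto (fun n => ((ϑ n).1 j).2.2) L (nhds (ϑ'.1 j).2.2) := fun j =>
    (hr.tendsto _).comp (hc₁ j)
  have hr₂ : ∀ k, Tendsto (fun n => ((ϑ n).2 k).2.2) L (nhds (ϑ'.2 k).2.2) := fun k =>
    (hr.tendsto _).comp (hc₂ k)
  have ha₁ : ∀ j, Tendsto (fun n => ((ϑ n).1 j).amp) L (nhds (ϑ'.1 j).amp) := fun j =>
    (Component.continuous_amp.tendsto _).comp (hc₁ j)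
  have ha₂ : ∀ k, Tendsto (fun n => ((ϑ n).2 k).amp) L (nhds (ϑ'.2 k).amp) := fun k =>
    (Component.continuous_amp.tendsto _).comp (hc₂ k)
  have hcst : ∀ x : ℝ, Tendsto (fun _ : ℕ => x) L (nhds x) := fun x => tendsto_const_nhds
  set ζ : Fin p ⊕ Fin q → ℂ := Sum.elim (fun j => (ϑ₀.1 j).amp) (fun k => (ϑ₀.2 k).amp) with hζ
  set φ : Fin p ⊕ Fin q → ℕ → ℕ → ℝ :=
    Sum.elim (fun j => linearPhase fun _ => (ϑ₀.1 j).2.2)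
      (fun k => quadraticPhase fun _ => (ϑ₀.2 k).2.2) with hφ
  set z : Fin p ⊕ Fin q → ℕ → ℂ :=
    Sum.elim (fun j n => ((ϑ n).1 j).amp) (fun k n => ((ϑ n).2 k).amp) with hz
  set ψ : Fin p ⊕ Fin q → ℕ → ℕ → ℝ :=
    Sum.elim (fun j => linearPhase fun n => ((ϑ n).1 j).2.2)
      (fun k => quadraticPhase fun n => ((ϑ n).2 k).2.2) with hψ
  set z' : Fin p ⊕ Fin q → ℂ := Sum.elim (fun j => (ϑ'.1 j).amp) (fun k => (ϑ'.2 k).amp) with hz'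
  have hzlim : ∀ l, Tendsto (z l) L (nhds (z' l)) := by
    rintro (j | k)
    · exact ha₁ j
    · exact ha₂ k
  have hmain : Tendsto (fun n => average n fun t =>
      (∑ k, osc (fun _ => ζ k) (φ k) n t - ∑ l, osc (z l) (ψ l) n t) ^ 2) L (nhds 0) := by
    refine h.congr fun n => average_congr fun t => ?_
    rw [signal_eq_sum_osc ϑ, signal_eq_sum_osc (fun _ => ϑ₀) n t]
    congr 3
    funext k
    rcases k with j | k <;> rfl
  -- decorrelation among the components of the true signal
  have hcc : ∀ k k', k' ≠ k → Decorrelated L (φ (.inr k)) (φ (.inr k')) := fun k k' hk =>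
    decorrelated_quadratic_quadratic hL (hcst _) (hcst _) (h_nonres.2 k k' hk.symm).1
      (h_nonres.2 k k' hk.symm).2
  have hcs : ∀ k j, Decorrelated L (φ (.inr k)) (φ (.inl j)) := fun k j =>
    decorrelated_quadratic_linear hL (hcst _) (h_nonres.1 k) _
  have hss : ∀ j j', j' ≠ j → Decorrelated L (φ (.inl j)) (φ (.inl j')) := fun j j' hj =>
    decorrelated_linear_linear hL (hcst _) (hcst _)
      (cis_add_ne_one (hα₀ j) (Set.Ioo_subset_Icc_self (hα₀ j')))
      fun h1 => hj (h_freq (eq_of_cis_sub_eq_one (hα₀ j) (Set.Ioo_subset_Icc_self (hα₀ j')) h1)).symm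
  -- every true chirp term is resonant with a fitted one
  have hex₂ : ∀ k, ∃ l, Resonant (ϑ₀.2 k).2.2 (ϑ'.2 l).2.2 := by
    intro k
    obtain ⟨l, hl⟩ := exists_not_decorrelated hL hzlim hmain (k := Sum.inr k)
      (Component.amp_ne_zero (h_chirp.2 k))
      (tendsto_average_cis_quadratic_double hL (hcst _)
        (irrational_double_of_irrational (h_nonres.1 k)))
      (by
        rintro (j | k') hk
        · exact hcs k j
        · exact hcc k k' fun e => hk (by rw [e]))
    rcases l with j | l
    · exact absurd (decorrelated_quadratic_linear hL (hcst _) (h_nonres.1 k) _) hl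
    · exact ⟨l, fun hirr =>
        hl (decorrelated_quadratic_quadratic hL (hcst _) (hr₂ l) hirr.1 hirr.2)⟩
  choose f hf using hex₂
  have hfinj : Function.Injective f := by
    intro k k' hk
    by_contra hne
    have h1 := hf k
    rw [hk] at h1
    exact h_nonres.not_resonant hne (h1.trans (hf k').symm)
  have hfsurj := Finite.injective_iff_surjective.1 hfinj
  have hirr : ∀ l, Irrational ((ϑ'.2 l).2.2 / Real.pi) := by
    intro l
    obtain ⟨k, rfl⟩ := hfsurj l
    exact irrational_of_not_resonant_zero fun h0 =>
      not_resonant_zero (h_nonres.1 k) ((hf k).trans h0)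
  have hchirp : ∀ k, ϑ'.2 (f k) = ϑ₀.2 k := by
    intro k
    have hsub := tendsto_average_sub_sq_of_decorrelated hL hzlim hmain (k := Sum.inr k)
      (l := Sum.inr (f k))
      (by
        rintro (j | k') hk
        · exact hcs k j
        · exact hcc k k' fun e => hk (by rw [e]))
      (by
        rintro (j | k') hk
        · exact decorrelated_quadratic_linear hL (hr₂ _) (hirr _) _
        · have hk' : k ≠ k' := fun e => hk (by rw [e])
          have := not_not.1 fun hres : Resonant (ϑ'.2 (f k)).2.2 (ϑ₀.2 k').2.2 =>
            h_nonres.not_resonant hk' ((hf k).trans hres)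
          exact decorrelated_quadratic_quadratic hL (hr₂ _) (hcst _) this.1 this.2)
      (by
        rintro (j | l) hl
        · exact decorrelated_quadratic_linear hL (hcst _) (h_nonres.1 k) _
        · obtain ⟨k', rfl⟩ := hfsurj l
          have hk' : k ≠ k' := fun e => hl (by rw [e])
          have := not_not.1 fun hres : Resonant (ϑ₀.2 k).2.2 (ϑ'.2 (f k')).2.2 =>
            h_nonres.not_resonant hk' (hres.trans (hf k').symm)
          exact decorrelated_quadratic_quadratic hL (hcst _) (hr₂ _) this.1 this.2)
      (by
        rintro (j | l) hl
        · exact decorrelated_quadratic_linear hL (hr₂ _) (hirr _) _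
        · obtain ⟨k', rfl⟩ := hfsurj l
          have hk' : k ≠ k' := fun e => hl (by rw [e])
          have := not_not.1 fun hres : Resonant (ϑ'.2 (f k)).2.2 (ϑ'.2 (f k')).2.2 =>
            h_nonres.not_resonant hk' ((hf k).trans (hres.trans (hf k').symm))
          exact decorrelated_quadratic_quadratic hL (hr₂ _) (hr₂ _) this.1 this.2)
    obtain ⟨h1, h2⟩ := chirp_limit_eq hL (Component.amp_ne_zero (h_chirp.2 k)) (ha₂ (f k))
      (hr₂ (f k)) (hβ₀ k) (hβ (f k)) (h_nonres.1 k) (hf k) hsub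
    exact Component.ext_amp h1 h2
  -- every true sinusoid has the limit frequency of a fitted one
  have hex₁ : ∀ j, ∃ i, (ϑ'.1 i).2.2 = (ϑ₀.1 j).2.2 := by
    intro j
    obtain ⟨l, hl⟩ := exists_not_decorrelated hL hzlim hmain (k := Sum.inl j)
      (Component.amp_ne_zero (h_sin.2 j))
      (tendsto_average_cis_linear_double hL (hcst _)
        (cis_add_ne_one (hα₀ j) (Set.Ioo_subset_Icc_self (hα₀ j))))
      (by
        rintro (j' | k) hj
        · exact hss j j' fun e => hj (by rw [e])
        · exact (hcs k j).symm)
    rcases l with i | l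
    · refine ⟨i, ?_⟩
      by_contra hne
      exact hl (decorrelated_linear_linear hL (hcst _) (hr₁ i) (cis_add_ne_one (hα₀ j) (hα i))
        fun h1 => hne (eq_of_cis_sub_eq_one (hα₀ j) (hα i) h1).symm)
    · exact absurd (decorrelated_quadratic_linear hL (hr₂ l) (hirr l) _).symm hl
  choose g hg using hex₁
  have hginj : Function.Injective g := by
    intro j j' hj
    refine h_freq ?_
    change (ϑ₀.1 j).2.2 = (ϑ₀.1 j').2.2
    rw [← hg j, ← hg j', hj]
  have hgsurj := Finite.injective_iff_surjective.1 hginj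
  have hdec : ∀ {a b : ℕ → ℝ} {j j' : Fin p}, j' ≠ j → Tendsto a L (nhds (ϑ₀.1 j).2.2) →
      Tendsto b L (nhds (ϑ₀.1 j').2.2) → Decorrelated L (linearPhase a) (linearPhase b) :=
    fun {a b j j'} hj ha hb => decorrelated_linear_linear hL ha hb
      (cis_add_ne_one (hα₀ j) (Set.Ioo_subset_Icc_self (hα₀ j')))
      fun h1 => hj (h_freq (eq_of_cis_sub_eq_one (hα₀ j) (Set.Ioo_subset_Icc_self (hα₀ j')) h1)).symm
  have hrg : ∀ j, Tendsto (fun n => ((ϑ n).1 (g j)).2.2) L (nhds (ϑ₀.1 j).2.2) := fun j =>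
    hg j ▸ hr₁ (g j)
  have hsin : ∀ j, ϑ'.1 (g j) = ϑ₀.1 j := by
    intro j
    have hsub := tendsto_average_sub_sq_of_decorrelated hL hzlim hmain (k := Sum.inl j)
      (l := Sum.inl (g j))
      (by
        rintro (j' | k) hj
        · exact hss j j' fun e => hj (by rw [e])
        · exact (hcs k j).symm)
      (by
        rintro (j' | k) hj
        · exact hdec (fun e => hj (by rw [e])) (hrg j) (hcst _)
        · exact (decorrelated_quadratic_linear hL (hcst _) (h_nonres.1 k) _).symm)
      (by
        rintro (i | l) hl
        · obtain ⟨j', rfl⟩ := hgsurj i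
          exact hdec (fun e => hl (by rw [e])) (hcst _) (hrg j')
        · exact (decorrelated_quadratic_linear hL (hr₂ l) (hirr l) _).symm)
      (by
        rintro (i | l) hl
        · obtain ⟨j', rfl⟩ := hgsurj i
          exact hdec (fun e => hl (by rw [e])) (hrg j) (hrg j')
        · exact (decorrelated_quadratic_linear hL (hr₂ l) (hirr l) _).symm)
    exact Component.ext_amp (sinusoid_limit_eq hL (Component.amp_ne_zero (h_sin.2 j)) (ha₁ (g j))
      (hrg j) (hα₀ j) hsub) (hg j)
  have hfid : f = id := eq_id_of_antitone_comp hfinj hord₂ h_chirp.1 fun k => by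
    simp only [hchirp k]
  have hgid : g = id := eq_id_of_antitone_comp hginj hord₁ h_sin.1 fun j => by
    simp only [hsin j]
  refine Prod.ext (funext fun j => ?_) (funext fun k => ?_)
  · simpa [hgid] using hsin j
  · simpa [hfid] using hchirp k

theorem tendsto_average_mul_wave {X : ℕ → ℝ} {d : ℕ} {M : ℝ}
    (hcos : ∀ θ : ℕ → ℝ, (∀ n, θ n ∈ Set.Icc 0 Real.pi) → Tendsto (fun n : ℕ =>
      (∑ t ∈ Finset.Icc 1 n, Real.cos (θ n * (t : ℝ) ^ d) * X t) / n) atTop (nhds 0))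
    (hsin : ∀ θ : ℕ → ℝ, (∀ n, θ n ∈ Set.Icc 0 Real.pi) → Tendsto (fun n : ℕ =>
      (∑ t ∈ Finset.Icc 1 n, Real.sin (θ n * (t : ℝ) ^ d) * X t) / n) atTop (nhds 0))
    {c : ℕ → Component} (hc : ∀ n, c n ∈ componentSpace M) :
    Tendsto (fun n => average n fun t => X t * (c n).wave ((t : ℝ) ^ d)) atTop (nhds 0) := by
  have hbd : ∀ {A r : ℕ → ℝ}, (∀ n, A n ∈ Set.Icc (-M) M) → Tendsto r atTop (nhds 0) →
      Tendsto (fun n => A n * r n) atTop (nhds 0) := by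
    intro A r hA hr
    refine squeeze_zero_norm (a := fun n => M * |r n|) (fun n => ?_) (by simpa using hr.abs.const_mul M)
    rw [Real.norm_eq_abs, abs_mul]
    exact mul_le_mul_of_nonneg_right (abs_le.2 (hA n)) (abs_nonneg _)
  have h := (hbd (fun n => (hc n).1) (hcos _ fun n => (hc n).2.2)).add
    (hbd (fun n => (hc n).2.1) (hsin _ fun n => (hc n).2.2))
  rw [add_zero] at h
  refine h.congr fun n => ?_
  change (c n).1 * average n _ + (c n).2.1 * average n _ = _
  rw [← average_const_mul, ← average_const_mul, ← average_add]
  refine average_congr fun t => ?_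
  rw [Component.wave]
  ring

theorem tendsto_average_mul_signal {p q : ℕ} {X : ℕ → ℝ} {M : ℝ}
    (hX : ∀ d ∈ Set.Icc 1 2, ∀ {c : ℕ → Component}, (∀ n, c n ∈ componentSpace M) →
      Tendsto (fun n => average n fun t => X t * (c n).wave ((t : ℝ) ^ d)) atTop (nhds 0))
    {ϑ : ℕ → Param p q} (hϑ : ∀ n, ϑ n ∈ paramSpace M p q) :
    Tendsto (fun n => average n fun t => X t * signal (ϑ n) t) atTop (nhds 0) := by
  have h1 := tendsto_finsetSum Finset.univ fun (j : Fin p) _ =>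
    hX 1 (by simp) (c := fun n => (ϑ n).1 j) fun n => (hϑ n).1 j (Set.mem_univ j)
  have h2 := tendsto_finsetSum Finset.univ fun (k : Fin q) _ =>
    hX 2 (by simp) (c := fun n => (ϑ n).2 k) fun n => (hϑ n).2 k (Set.mem_univ k)
  have h := h1.add h2
  simp only [Finset.sum_const_zero, add_zero, pow_one] at h
  refine h.congr fun n => ?_
  rw [← average_sum, ← average_sum, ← average_add]
  refine average_congr fun t => ?_
  rw [signal, mul_add, Finset.mul_sum, Finset.mul_sum]

theorem average_sq_le_of_errorSS_le {p q : ℕ} {X y : ℕ → ℝ} {n : ℕ} {ϑ₀ ϑ : Param p q}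
    (hy : ∀ t, 1 ≤ t → y t = signal ϑ₀ t + X t) (h : errorSS y n ϑ ≤ errorSS y n ϑ₀) :
    average n (fun t => (signal ϑ₀ t - signal ϑ t) ^ 2) ≤
      2 * (average n (fun t => X t * signal ϑ t) - average n fun t => X t * signal ϑ₀ t) := by
  rw [← average_sub, ← average_const_mul]
  refine div_le_div_of_nonneg_right ?_ (Nat.cast_nonneg n)
  have e : ∑ t ∈ Finset.Icc 1 n, 2 * (X t * signal ϑ t - X t * signal ϑ₀ t) -
      ∑ t ∈ Finset.Icc 1 n, (signal ϑ₀ t - signal ϑ t) ^ 2 =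
      errorSS y n ϑ₀ - errorSS y n ϑ := by
    rw [errorSS, errorSS, ← Finset.sum_sub_distrib, ← Finset.sum_sub_distrib]
    refine Finset.sum_congr rfl fun t ht => ?_
    rw [hy t (Finset.mem_Icc.1 ht).1]
    ring
  linarith

theorem tendsto_of_isLSE {p q : ℕ} {M : ℝ} {X y : ℕ → ℝ} {ϑ₀ : Param p q} {ϑ : ℕ → Param p q}
    (h_interior : ϑ₀ ∈ interior (paramSpace M p q))
    (h_freq : Function.Injective fun j => (ϑ₀.1 j).2.2) (h_nonres : NonResonant ϑ₀.2)
    (h_sin : StrictlyOrdered ϑ₀.1) (h_chirp : StrictlyOrdered ϑ₀.2)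
    (hX : ∀ d ∈ Set.Icc 1 2, ∀ {c : ℕ → Component}, (∀ n, c n ∈ componentSpace M) →
      Tendsto (fun n => average n fun t => X t * (c n).wave ((t : ℝ) ^ d)) atTop (nhds 0))
    (hy : ∀ t, 1 ≤ t → y t = signal ϑ₀ t + X t) (h_lse : ∀ n, 1 ≤ n → IsLSE M y n (ϑ n)) :
    Tendsto ϑ atTop (nhds ϑ₀) := by
  have hϑ₀ := interior_subset h_interior
  set η : ℕ → Param p q := fun n => if 1 ≤ n then ϑ n else ϑ₀ with hη
  have hηmem : ∀ n, η n ∈ paramSpace M p q := by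
    intro n
    simp only [hη]
    split_ifs with hn
    · exact (h_lse n hn).mem
    · exact hϑ₀
  have heq : ∀ᶠ n in atTop, η n = ϑ n := by
    filter_upwards [eventually_ge_atTop 1] with n hn
    simp only [hη, if_pos hn]
  refine Tendsto.congr' heq ?_
  have hsq : Tendsto (fun n => average n fun t => (signal ϑ₀ t - signal (η n) t) ^ 2) atTop
      (nhds 0) := by
    have hbound := ((tendsto_average_mul_signal hX hηmem).sub
      (tendsto_average_mul_signal hX fun _ => hϑ₀)).const_mul 2
    rw [sub_zero, mul_zero] at hbound
    refine squeeze_zero' (Eventually.of_forall fun n => average_nonneg fun t => sq_nonneg _) ?_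
      hbound
    filter_upwards [eventually_ge_atTop 1, heq] with n hn hn'
    rw [hn']
    exact average_sq_le_of_errorSS_le hy ((h_lse n hn).isMin _ hϑ₀)
  rw [tendsto_iff_ultrafilter]
  intro G hG
  have hGmem : Tendsto η G (Filter.principal (paramSpace M p q)) :=
    tendsto_principal.2 (Eventually.of_forall hηmem)
  obtain ⟨ϑ', hϑ'mem, hϑ'⟩ := (isCompact_paramSpace M p q).ultrafilter_le_nhds (G.map η) hGmem
  have hord : ∀ᶠ n in (G : Filter ℕ), (Antitone fun j => ((η n).1 j).power) ∧
      Antitone fun k => ((η n).2 k).power := by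
    refine hG ?_
    filter_upwards [eventually_ge_atTop 1, heq] with n hn hn'
    rw [hn']
    exact ⟨(h_lse n hn).sinusoids_ordered, (h_lse n hn).chirps_ordered⟩
  have hlim : Tendsto η G (nhds ϑ') := hϑ'
  have hcp₁ : ∀ j, Continuous fun ϑ : Param p q => (ϑ.1 j).power := fun j =>
    Component.continuous_power.comp (by fun_prop)
  have hcp₂ : ∀ k, Continuous fun ϑ : Param p q => (ϑ.2 k).power := fun k =>
    Component.continuous_power.comp (by fun_prop)
  have hp₁ := fun j => ((hcp₁ j).tendsto ϑ').comp hlim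
  have hp₂ := fun k => ((hcp₂ k).tendsto ϑ').comp hlim
  obtain ⟨hα₀, hβ₀⟩ := rates_mem_Ioo_of_mem_interior h_interior
  have heq' := limit_eq_of_average_signal_sub_sq hG hα₀ hβ₀ h_freq h_nonres h_sin h_chirp hlim
    (fun j => (hϑ'mem.1 j (Set.mem_univ j)).2.2) (fun k => (hϑ'mem.2 k (Set.mem_univ k)).2.2)
    (fun i j hij => le_of_tendsto_of_tendsto (hp₁ j) (hp₁ i) (hord.mono fun n hn => hn.1 hij))
    (fun i j hij => le_of_tendsto_of_tendsto (hp₂ j) (hp₂ i) (hord.mono fun n hn => hn.2 hij))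
    (hsq.mono_left hG)
  rwa [heq'] at hlim

theorem IsLinearNoise.ae_tendsto_average_mul_wave {Ω : Type*} [MeasurableSpace Ω] {P : Measure Ω}
    [IsProbabilityMeasure P] {σ : ℝ} {a : ℤ → ℝ} {e X : ℤ → Ω → ℝ} (hX : IsLinearNoise P σ a e X)
    (M : ℝ) :
    ∀ᵐ ω ∂P, ∀ d ∈ Set.Icc 1 2, ∀ {c : ℕ → Component}, (∀ n, c n ∈ componentSpace M) →
      Tendsto (fun n => average n fun t => X t ω * (c n).wave ((t : ℝ) ^ d)) atTop (nhds 0) := by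
  have key : ∀ d ∈ Set.Icc 1 2, ∀ᵐ ω ∂P, ∀ {c : ℕ → Component}, (∀ n, c n ∈ componentSpace M) →
      Tendsto (fun n => average n fun t => X t ω * (c n).wave ((t : ℝ) ^ d)) atTop (nhds 0) := by
    intro d hd
    filter_upwards [
      hX.ae_tendsto_weighted_average
        (isWeightFamily_comp_mul_pow Real.abs_cos_le_one abs_cos_sub_cos_le hd),
      hX.ae_tendsto_weighted_average
        (isWeightFamily_comp_mul_pow Real.abs_sin_le_one abs_sin_sub_sin_le hd)] with ω h1 h2 c hc
    exact ChirpLike.tendsto_average_mul_wave (X := fun t : ℕ => X t ω) h1 h2 hc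
  filter_upwards [key 1 (by simp), key 2 (by simp)] with ω h1 h2 d hd c hc
  obtain rfl | rfl : d = 1 ∨ d = 2 := by
    have := hd.1
    have := hd.2
    omega
  · exact h1 hc
  · exact h2 hc

end ChirpLike

theorem theorem5 {Ω : Type*} [MeasurableSpace Ω] (P : Measure Ω) [IsProbabilityMeasure P]
    (p q : ℕ) (M : ℝ) (hM : 0 < M)
    (σ : ℝ) (a : ℤ → ℝ) (e X : ℤ → Ω → ℝ) (hX : ChirpLike.IsLinearNoise P σ a e X)
    (ϑ₀ : ChirpLike.Param p q)
    (h_interior : ϑ₀ ∈ interior (ChirpLike.paramSpace M p q))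
    (h_freq : Function.Injective fun j => (ϑ₀.1 j).2.2)
    (h_rate : Function.Injective fun k => (ϑ₀.2 k).2.2)
    (h_nonres : ChirpLike.NonResonant ϑ₀.2)
    (h_sin : ChirpLike.StrictlyOrdered ϑ₀.1)
    (h_chirp : ChirpLike.StrictlyOrdered ϑ₀.2)
    (y : ℕ → Ω → ℝ)
    (hy : ∀ t : ℕ, 1 ≤ t → ∀ᵐ ω ∂P, y t ω = ChirpLike.signal ϑ₀ t + X t ω)
    (ϑhat : ℕ → Ω → ChirpLike.Param p q)
    (h_lse : ∀ n : ℕ, 1 ≤ n → ∀ᵐ ω ∂P,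
      ChirpLike.IsLSE M (fun t => y t ω) n (ϑhat n ω)) :
    ∀ᵐ ω ∂P, Tendsto (fun n => ϑhat n ω) atTop (nhds ϑ₀) := by
  have hy' : ∀ᵐ ω ∂P, ∀ t : ℕ, 1 ≤ t → y t ω = ChirpLike.signal ϑ₀ t + X t ω :=
    ae_all_iff.2 fun t => eventually_imp_distrib_left.2 (hy t)
  have h_lse' : ∀ᵐ ω ∂P, ∀ n : ℕ, 1 ≤ n → ChirpLike.IsLSE M (fun t => y t ω) n (ϑhat n ω) :=
    ae_all_iff.2 fun n => eventually_imp_distrib_left.2 (h_lse n)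
  filter_upwards [hy', h_lse', hX.ae_tendsto_average_mul_wave M] with ω h1 h2 h3
  exact ChirpLike.tendsto_of_isLSE (X := fun t : ℕ => X t ω) h_interior h_freq h_nonres h_sin
    h_chirp h3 h1 h2
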